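/- Let $G$ be a countable group. Let $Gen(G)$ be the set of all generating sets of $G$ with the subspace topology from the product space $2^G$. For $X\in Gen(G)$ let $|\cdot|_X$ and $\mathrm d_X(g,h)=|g^{-1}h|_X$ be the word length and word metric, and let $Cay(G,X)$ be the Cayley graph with its path metric in which every edge is identified with $[0,1]$, with $G$ acting by left multiplication. Write $X\preccurlyeq Y$ if the identity map $(G,\mathrm d_Y)\to(G,\mathrm d_X)$ is Lipschitz, and $X\sim Y$ if $X\preccurlyeq Y$ and $Y\preccurlyeq X$. Let $PL(G)$ be the set of pseudo-length functions on $G$, i.e. maps $\ell\colon G\to[0,\infty)$ with $\ell(1)=0$, $\ell(g^{-1})=\ell(g)$ and $\ell(gh)\le \ell(g)+\ell(h)$ for all $g,h\in G$, with the topology of pointwise convergence. Write $\ell_1\preccurlyeq_{PL}\ell_2$ if there is $C>0$ such that $\ell_1(g)\le C\ell_2(g)+C$ for all $g\in G$, and $\ell_1\sim_{PL}\ell_2$ if $\ell_1\preccurlyeq_{PL}\ell_2$ and $\ell_2\preccurlyeq_{PL}\ell_1$. A hyperbolic space is a geodesic metric space that is hyperbolic in the sense of Gromov; actions are by isometries.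 An action of $G$ on a hyperbolic space $S$ is of general type if its limit set $\overline{Gs}\cap\partial S$ (where $s\in S$ and the closure is taken in $S\cup\partial S$) is infinite and $G$ fixes no point of the Gromov boundary $\partial S$. Let $Hyp(G)$ be the set of all $X\in Gen(G)$ such that $Cay(G,X)$ is hyperbolic, and let $Hyp_{gt}(G)$ be the set of all $X\in Hyp(G)$ such that $\partial Cay(G,X)$ is infinite and $G$ fixes no point of $\partial Cay(G,X)$. Let $HypPL(G)$ (respectively, $HypPL_{gt}(G)$) be the set of all $\ell\in PL(G)$ such that there are an action (respectively, a general type action) of $G$ on a hyperbolic space $S$ and a point $s\in S$ with $\ell(g)=\mathrm d_S(s,gs)$ for all $g\in G$. Then the following hold. \begin{enumerate} \item[(a)] $Gen(G)$ is a Polish space, $\preccurlyeq$ is a quasi-order and $\sim$ is an equivalence relation on $Gen(G)$, and both are Borel subsets of $Gen(G)\times Gen(G)$. \item[(b)] $PL(G)$ is a Polish space, $\preccurlyeq_{PL}$ is a quasi-order and $\sim_{PL}$ is an equivalence relation on $PL(G)$, and both are Borel subsets of $PL(G)\times PL(G)$. \item[(c)] The map $Gen(G)\to PL(G)$, $X\mapsto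 |\cdot|_X$, is Borel, and for all $X,Y\in Gen(G)$ we have $X\preccurlyeq Y$ if and only if $|\cdot|_X\preccurlyeq_{PL}|\cdot|_Y$, and $X\sim Y$ if and only if $|\cdot|_X\sim_{PL}|\cdot|_Y$. \item[(d)] $Hyp(G)$ and $Hyp_{gt}(G)$ are Borel subsets of $Gen(G)$. \item[(e)] $HypPL(G)$ and $HypPL_{gt}(G)$ are Borel subsets of $PL(G)$. \end{enumerate} -/

import Mathlib

open Filter Topology MeasureTheory

noncomputable section

universe u

namespace HypAct

/-! ### Generating sets and word lengths -/

section Words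

variable {G : Type u} [Group G]

/-- The space `Gen(G)` of generating sets of `G`, as a subspace of `2^G` with its product topology
(`Bool` is discrete); a subset of `G` is encoded by its indicator function. -/
abbrev Gen (G : Type u) [Group G] : Type u :=
  {χ : G → Bool // Subgroup.closure {g : G | χ g = true} = ⊤}

/-- The underlying generating set. -/
def Gen.set (X : Gen G) : Set G := {g : G | X.1 g = true}

/-- `g` is a product of `n` elements of `X ∪ X⁻¹`. -/
def IsWordOfLength (X : Set G) (n : ℕ) (g : G) : Prop :=
  ∃ w : List G, w.length = n ∧ (∀ a ∈ w, a ∈ X ∨ a⁻¹ ∈ X) ∧ w.prod = g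

/-- The word length `|g|_X`. -/
def wordLength (X : Gen G) (g : G) : ℕ := sInf {n : ℕ | IsWordOfLength X.set n g}

/-- The word metric `d_X(g, h) = |g⁻¹h|_X` on `G`. -/
def wordDist (X : Gen G) (g h : G) : ℝ := (wordLength X (g⁻¹ * h) : ℝ)

theorem IsWordOfLength.mul {X : Set G} {m n : ℕ} {g h : G} (hg : IsWordOfLength X m g)
    (hh : IsWordOfLength X n h) : IsWordOfLength X (m + n) (g * h) := by
  obtain ⟨v, rfl, hv, rfl⟩ := hg
  obtain ⟨w, rfl, hw, rfl⟩ := hh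
  refine ⟨v ++ w, by simp, fun a ha => ?_, by simp⟩
  rcases List.mem_append.1 ha with h | h
  · exact hv a h
  · exact hw a h

theorem IsWordOfLength.inv {X : Set G} {n : ℕ} {g : G} (hg : IsWordOfLength X n g) :
    IsWordOfLength X n g⁻¹ := by
  obtain ⟨v, rfl, hv, rfl⟩ := hg
  refine ⟨(v.map fun x => x⁻¹).reverse, by simp, fun a ha => ?_, (List.prod_inv_reverse v).symm⟩
  simp only [List.mem_reverse, List.mem_map] at ha
  obtain ⟨b, hb, rfl⟩ := ha
  rcases hv b hb with h | h
  · exact Or.inr (by simpa using h)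
  · exact Or.inl h

theorem exists_isWordOfLength (X : Gen G) (g : G) : ∃ n, IsWordOfLength X.set n g := by
  have hg : g ∈ Subgroup.closure X.set := by
    have h : Subgroup.closure X.set = ⊤ := X.2
    rw [h]; trivial
  induction hg using Subgroup.closure_induction with
  | mem x hx => exact ⟨1, [x], rfl, by simpa using Or.inl hx, by simp⟩
  | one => exact ⟨0, [], rfl, by simp, rfl⟩
  | mul x y _ _ hx hy =>
    obtain ⟨m, hm⟩ := hx
    obtain ⟨n, hn⟩ := hy
    exact ⟨m + n, hm.mul hn⟩
  | inv x _ hx =>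
    obtain ⟨n, hn⟩ := hx
    exact ⟨n, hn.inv⟩

theorem isWordOfLength_wordLength (X : Gen G) (g : G) :
    IsWordOfLength X.set (wordLength X g) g :=
  Nat.sInf_mem (exists_isWordOfLength X g)

theorem wordLength_le {X : Gen G} {n : ℕ} {g : G} (h : IsWordOfLength X.set n g) :
    wordLength X g ≤ n := Nat.sInf_le h

theorem wordLength_one (X : Gen G) : wordLength X 1 = 0 :=
  Nat.le_zero.1 (wordLength_le ⟨[], rfl, by simp, rfl⟩)

theorem wordLength_inv (X : Gen G) (g : G) : wordLength X g⁻¹ = wordLength X g := by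
  apply le_antisymm
  · exact wordLength_le (isWordOfLength_wordLength X g).inv
  · simpa using wordLength_le (isWordOfLength_wordLength X g⁻¹).inv

theorem wordLength_mul_le (X : Gen G) (g h : G) :
    wordLength X (g * h) ≤ wordLength X g + wordLength X h :=
  wordLength_le ((isWordOfLength_wordLength X g).mul (isWordOfLength_wordLength X h))

theorem eq_one_of_wordLength_eq_zero {X : Gen G} {g : G} (h : wordLength X g = 0) : g = 1 := by
  obtain ⟨w, hw, -, rfl⟩ := isWordOfLength_wordLength X g
  rw [h, List.length_eq_zero_iff] at hw
  simp [hw]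

theorem wordDist_nonneg (X : Gen G) (g h : G) : 0 ≤ wordDist X g h := Nat.cast_nonneg _

theorem wordDist_self (X : Gen G) (g : G) : wordDist X g g = 0 := by
  simp [wordDist, wordLength_one]

theorem wordDist_comm (X : Gen G) (g h : G) : wordDist X g h = wordDist X h g := by
  rw [wordDist, wordDist, ← wordLength_inv]
  simp

theorem wordDist_triangle (X : Gen G) (f g h : G) :
    wordDist X f h ≤ wordDist X f g + wordDist X g h := by
  have := wordLength_mul_le X (f⁻¹ * g) (g⁻¹ * h)
  rw [show f⁻¹ * g * (g⁻¹ * h) = f⁻¹ * h by group] at this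
  unfold wordDist
  exact_mod_cast this

theorem wordDist_mul_left (X : Gen G) (f g h : G) :
    wordDist X (f * g) (f * h) = wordDist X g h := by
  unfold wordDist
  rw [show (f * g)⁻¹ * (f * h) = g⁻¹ * h by group]

theorem wordDist_mul_gen_le (X : Gen G) (g x : G) (hx : x ∈ X.set) :
    wordDist X g (g * x) ≤ 1 := by
  have : wordLength X (g⁻¹ * (g * x)) ≤ 1 :=
    wordLength_le ⟨[x], rfl, by simpa using Or.inl hx, by simp⟩
  unfold wordDist
  exact_mod_cast this

/-- `X ≼ Y`: the identity map `(G, d_Y) → (G, d_X)` is Lipschitz. -/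
def Gen.Dominated (X Y : Gen G) : Prop :=
  ∃ K : ℝ, 0 ≤ K ∧ ∀ g h : G, wordDist X g h ≤ K * wordDist Y g h

/-- `X ∼ Y`. -/
def Gen.Equiv (X Y : Gen G) : Prop := Gen.Dominated X Y ∧ Gen.Dominated Y X

end Words

/-! ### Pseudo-length functions -/

section PseudoLength

variable {G : Type u} [Group G]

/-- Pseudo-length functions on `G`. -/
structure IsPseudoLength (l : G → ℝ) : Prop where
  nonneg : ∀ g, 0 ≤ l g
  one : l 1 = 0
  inv : ∀ g, l g = l g⁻¹
  mul_le : ∀ g h, l (g * h) ≤ l g + l h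

/-- The space `PL(G)` of pseudo-length functions with the topology of pointwise convergence
(the subspace topology from the product space `ℝ^G`). -/
abbrev PL (G : Type u) [Group G] : Type u := {l : G → ℝ // IsPseudoLength l}

/-- `l₁ ≼_PL l₂`. -/
def PL.Dominated (l₁ l₂ : PL G) : Prop :=
  ∃ C : ℝ, 0 < C ∧ ∀ g : G, l₁.1 g ≤ C * l₂.1 g + C

/-- `l₁ ∼_PL l₂`. -/
def PL.Equiv (l₁ l₂ : PL G) : Prop := PL.Dominated l₁ l₂ ∧ PL.Dominated l₂ l₁

/-- The word length with respect to `X`, as an element of `PL(G)`. -/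
def wordPL (X : Gen G) : PL G :=
  ⟨fun g => (wordLength X g : ℝ),
    { nonneg := fun _ => Nat.cast_nonneg _
      one := by simp [wordLength_one]
      inv := fun g => by simp only [wordLength_inv]
      mul_le := fun g h => by exact_mod_cast wordLength_mul_le X g h }⟩

end PseudoLength

/-! ### Hyperbolic spaces -/

section Hyperbolic

variable {S : Type u} [MetricSpace S]

/-- The Gromov product `(x, y)_z`. -/
def gromovProduct (x y z : S) : ℝ := (dist x z + dist y z - dist x y) / 2

/-- `A` is (the image of) a geodesic path from `x` to `y`. -/
def IsGeodesicSegment (x y : S) (A : Set S) : Prop :=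
  ∃ c : ℝ → S, c 0 = x ∧ c (dist x y) = y ∧
    (∀ s ∈ Set.Icc 0 (dist x y), ∀ t ∈ Set.Icc 0 (dist x y), dist (c s) (c t) = |s - t|) ∧
    A = c '' Set.Icc 0 (dist x y)

/-- Any two points are connected by a geodesic path. -/
def IsGeodesicSpace (S : Type u) [MetricSpace S] : Prop :=
  ∀ x y : S, ∃ A, IsGeodesicSegment x y A

/-- Geodesic triangles are `δ`-slim: every side lies in the union of the closed
`δ`-neighborhoods of the other two. -/
def SlimTriangles (S : Type u) [MetricSpace S] (δ : ℝ) : Prop :=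
  ∀ (x y z : S) (A B C : Set S), IsGeodesicSegment x y A → IsGeodesicSegment y z B →
    IsGeodesicSegment x z C → ∀ u ∈ A, ∃ v ∈ B ∪ C, dist u v ≤ δ

/-- Geodesic triangles are `δ`-thin: conjugate points are at distance at most `δ`. -/
def ThinTriangles (S : Type u) [MetricSpace S] (δ : ℝ) : Prop :=
  ∀ (x y z : S) (A B : Set S), IsGeodesicSegment x z A → IsGeodesicSegment y z B →
    ∀ u ∈ A, ∀ v ∈ B, dist u z = dist v z → dist u z ≤ gromovProduct x y z → dist u v ≤ δ

/-- The four-point condition. -/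
def FourPoint (S : Type u) [MetricSpace S] (δ : ℝ) : Prop :=
  ∀ x y z t : S, min (gromovProduct x y t) (gromovProduct y z t) - δ ≤ gromovProduct x z t

/-- A (Gromov) hyperbolic space. -/
def IsHyperbolic (S : Type u) [MetricSpace S] : Prop :=
  IsGeodesicSpace S ∧ ∃ δ : ℝ, 0 ≤ δ ∧ SlimTriangles S δ ∧ ThinTriangles S δ ∧ FourPoint S δ

/-! ### The Gromov boundary -/

/-- `lim_{i,j → ∞} (x_i, y_j)_o = ∞` for every base point `o` (equivalently, for some `o`). -/
def ProductTendsToInfinity (x y : ℕ → S) : Prop :=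
  ∀ o : S, Tendsto (fun p : ℕ × ℕ => gromovProduct (x p.1) (y p.2) o) (atTop ×ˢ atTop) atTop

/-- Sequences converging to infinity. -/
def SeqToInfinity (S : Type u) [MetricSpace S] : Type u :=
  {x : ℕ → S // ProductTendsToInfinity x x}

/-- The Gromov boundary `∂S`: sequences converging to infinity modulo equivalence. (When `S` is
hyperbolic, the relation below is an equivalence relation.) -/
def Boundary (S : Type u) [MetricSpace S] : Type u :=
  Quot fun x y : SeqToInfinity S => ProductTendsToInfinity x.1 y.1

/-- The bordification `S ∪ ∂S`. -/
inductive Bordification (S : Type u) [MetricSpace S] : Type u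
  | point (x : S) : Bordification S
  | infinity (ξ : Boundary S) : Bordification S

/-- The sequence `a` represents the point `p` of `S ∪ ∂S`. -/
def Represents (a : ℕ → S) : Bordification S → Prop
  | .point x => ∀ n, a n = x
  | .infinity ξ => ∃ h : ProductTendsToInfinity a a, Quot.mk _ (⟨a, h⟩ : SeqToInfinity S) = ξ

/-- The Gromov product on `S ∪ ∂S`: the infimum of `liminf_{i,j} (a_i, b_j)_o` over all sequences
`a`, `b` representing the given points. -/
def extGromovProduct (p q : Bordification S) (o : S) : EReal :=
  ⨅ (a : ℕ → S) (b : ℕ → S) (_ : Represents a p) (_ : Represents b q),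
    liminf (fun k : ℕ × ℕ => ((gromovProduct (a k.1) (b k.2) o : ℝ) : EReal)) (atTop ×ˢ atTop)

/-- The topology of `S ∪ ∂S`: a set `U` is open if `U ∩ S` is open in `S` and, for all `ξ ∈ U ∩ ∂S`,
`U` contains `{p | (p, ξ)_o > t}` for some `t`. -/
instance : TopologicalSpace (Bordification S) where
  IsOpen U := IsOpen {x : S | Bordification.point x ∈ U} ∧
    ∀ ξ : Boundary S, Bordification.infinity ξ ∈ U → ∀ o : S, ∃ t : ℝ,
      ∀ p : Bordification S, (t : EReal) < extGromovProduct p (Bordification.infinity ξ) o → p ∈ U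
  isOpen_univ := ⟨isOpen_univ, fun _ _ _ => ⟨0, fun _ _ => trivial⟩⟩
  isOpen_inter := by
    rintro U V ⟨hU, hU'⟩ ⟨hV, hV'⟩
    refine ⟨hU.inter hV, fun ξ hξ o => ?_⟩
    obtain ⟨s, hs⟩ := hU' ξ hξ.1 o
    obtain ⟨t, ht⟩ := hV' ξ hξ.2 o
    refine ⟨max s t, fun p hp => ⟨hs p (lt_of_le_of_lt ?_ hp), ht p (lt_of_le_of_lt ?_ hp)⟩⟩
    · exact_mod_cast le_max_left s t
    · exact_mod_cast le_max_right s t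
  isOpen_sUnion := by
    intro F hF
    constructor
    · have : {x : S | Bordification.point x ∈ ⋃₀ F} =
          ⋃ U ∈ F, {x : S | Bordification.point x ∈ U} := by
        ext x
        simp
      rw [this]
      exact isOpen_biUnion fun U hU => (hF U hU).1
    · rintro ξ ⟨U, hU, hξ⟩ o
      obtain ⟨t, ht⟩ := (hF U hU).2 ξ hξ o
      exact ⟨t, fun p hp => ⟨U, hU, ht p hp⟩⟩

/-! ### Isometric actions -/

variable {G : Type u} [Group G] [MulAction G S] [IsIsometricSMul G S]

theorem gromovProduct_smul (g : G) (x y z : S) :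
    gromovProduct (g • x) (g • y) (g • z) = gromovProduct x y z := by
  simp [gromovProduct, dist_smul]

theorem ProductTendsToInfinity.smul {x y : ℕ → S} (h : ProductTendsToInfinity x y) (g : G) :
    ProductTendsToInfinity (fun n => g • x n) (fun n => g • y n) := by
  intro o
  have := h (g⁻¹ • o)
  refine this.congr fun p => ?_
  rw [← gromovProduct_smul g, smul_inv_smul]

/-- The induced action on the boundary, `g[(x_i)] = [(g x_i)]`. -/
def boundarySMul (g : G) : Boundary S → Boundary S :=
  Quot.map (fun x : SeqToInfinity S => (⟨fun n => g • x.1 n, x.2.smul g⟩ : SeqToInfinity S))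
    fun _ _ h => ProductTendsToInfinity.smul h g

/-- `G` fixes a point of `∂S`. -/
def FixesBoundaryPoint (G S : Type u) [Group G] [MetricSpace S] [MulAction G S]
    [IsIsometricSMul G S] : Prop :=
  ∃ ξ : Boundary S, ∀ g : G, boundarySMul g ξ = ξ

/-- The set of limit points of `G` on `∂S`: the boundary points in the closure of the orbit `Gs`
(this does not depend on `s`). -/
def limitSet (G : Type u) {S : Type u} [Group G] [MetricSpace S] [MulAction G S] (s : S) :
    Set (Boundary S) :=
  {ξ | Bordification.infinity ξ ∈
    closure (Set.range fun g : G => Bordification.point (g • s))}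

/-- The action of `G` on `S` is of general type: the limit set is infinite and `G` does not fix
any point of `∂S`. -/
def IsGeneralType (G S : Type u) [Group G] [MetricSpace S] [MulAction G S]
    [IsIsometricSMul G S] : Prop :=
  (∃ s : S, (limitSet G s).Infinite) ∧ ¬ FixesBoundaryPoint G S

end Hyperbolic

/-! ### Cayley graphs -/

section Cayley

variable {G : Type u} [Group G]

/-- The Cayley graph of `G` with respect to `X` as a set of points: its vertices are the elements
of `G`, and for every `g ∈ G`, `x ∈ X` there is an edge from `g` to `gx`, identified with `[0, 1]`;
`edge g x t` is the interior point of that edge with coordinate `t ∈ (0, 1)`. -/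
inductive Cay (X : Gen G) : Type u
  | vertex (g : G) : Cay X
  | edge (g : G) (x : X.set) (t : Set.Ioo (0 : ℝ) 1) : Cay X

namespace Cay

variable {X : Gen G}

/-- The two endpoints of an edge containing the point (a vertex is its own endpoint). -/
def endpoint : Cay X → Bool → G
  | vertex g, _ => g
  | edge g _ _, false => g
  | edge g x _, true => g * x

/-- The distances, along the edge, from the point to the two endpoints. -/
def offset : Cay X → Bool → ℝ
  | vertex _, _ => 0
  | edge _ _ t, false => t
  | edge _ _ t, true => 1 - t

/-- The smallest length of a path from `p` to `q` that passes through a vertex. -/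
def viaVertices (p q : Cay X) : ℝ :=
  (Finset.univ : Finset (Bool × Bool)).inf' Finset.univ_nonempty fun k =>
    offset p k.1 + wordDist X (endpoint p k.1) (endpoint q k.2) + offset q k.2

open Classical in
/-- The standard (path) metric on the Cayley graph: a shortest path passes through a vertex,
unless it stays inside one edge. -/
def cayDist : Cay X → Cay X → ℝ
  | edge g x s, edge h y t =>
    if g = h ∧ x = y then min |(s : ℝ) - t| (viaVertices (edge g x s) (edge h y t))
    else viaVertices (edge g x s) (edge h y t)
  | p, q => viaVertices p q

theorem offset_nonneg (p : Cay X) (k : Bool) : 0 ≤ offset p k := by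
  rcases p with g | ⟨g, x, t, h0, h1⟩
  · exact le_rfl
  · cases k
    · exact h0.le
    · exact sub_nonneg.2 h1.le

theorem viaVertices_le (p q : Cay X) (j k : Bool) : viaVertices p q ≤
    offset p j + wordDist X (endpoint p j) (endpoint q k) + offset q k :=
  Finset.inf'_le (fun k : Bool × Bool =>
    offset p k.1 + wordDist X (endpoint p k.1) (endpoint q k.2) + offset q k.2)
    (Finset.mem_univ (j, k))

theorem exists_viaVertices (p q : Cay X) : ∃ j k : Bool, viaVertices p q =
    offset p j + wordDist X (endpoint p j) (endpoint q k) + offset q k := by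
  obtain ⟨k, -, hk⟩ := Finset.exists_mem_eq_inf' (s := (Finset.univ : Finset (Bool × Bool)))
    Finset.univ_nonempty (fun k : Bool × Bool =>
      offset p k.1 + wordDist X (endpoint p k.1) (endpoint q k.2) + offset q k.2)
  exact ⟨k.1, k.2, hk⟩

theorem viaVertices_comm_le (p q : Cay X) : viaVertices p q ≤ viaVertices q p := by
  obtain ⟨j, k, h⟩ := exists_viaVertices q p
  have := viaVertices_le p q k j
  rw [wordDist_comm] at this
  linarith

theorem endpoint_dist_le (p : Cay X) (j k : Bool) :
    wordDist X (endpoint p j) (endpoint p k) ≤ offset p j + offset p k := by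
  by_cases hjk : j = k
  · subst hjk
    rw [wordDist_self]
    linarith [offset_nonneg p j]
  · rcases p with g | ⟨g, x, t⟩
    · simp [endpoint, offset, wordDist_self]
    · have hx := wordDist_mul_gen_le X g x x.2
      cases j <;> cases k <;> simp_all [endpoint, offset]
      rwa [wordDist_comm]

theorem viaVertices_triangle (p q r : Cay X) :
    viaVertices p r ≤ viaVertices p q + viaVertices q r := by
  obtain ⟨i, j, h⟩ := exists_viaVertices p q
  obtain ⟨k, l, h'⟩ := exists_viaVertices q r
  have h1 := viaVertices_le p r i l
  have h2 := endpoint_dist_le q j k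
  have h3 := wordDist_triangle X (endpoint p i) (endpoint q j) (endpoint r l)
  have h4 := wordDist_triangle X (endpoint q j) (endpoint q k) (endpoint r l)
  linarith

theorem cayDist_le_viaVertices (p q : Cay X) : cayDist p q ≤ viaVertices p q := by
  rcases p with g | ⟨g, x, s⟩ <;> rcases q with h | ⟨h, y, t⟩ <;> simp only [cayDist, le_refl]
  split_ifs
  · exact min_le_right _ _
  · exact le_rfl

theorem cayDist_le_abs (g : G) (x : X.set) (s t : Set.Ioo (0 : ℝ) 1) :
    cayDist (edge g x s) (edge g x t) ≤ |(s : ℝ) - t| := by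
  simp [cayDist]

theorem cayDist_cases (p q : Cay X) : cayDist p q = viaVertices p q ∨
    ∃ g x s t, p = edge g x s ∧ q = edge g x t ∧ cayDist p q = |(s : ℝ) - t| := by
  rcases p with g | ⟨g, x, s⟩ <;> rcases q with h | ⟨h, y, t⟩ <;>
    simp only [cayDist, true_or]
  split_ifs with hgh
  · obtain ⟨rfl, rfl⟩ := hgh
    rcases min_choice |(s : ℝ) - t| (viaVertices (edge g x s) (edge g x t)) with h | h
    · exact Or.inr ⟨g, x, s, t, rfl, rfl, h⟩
    · exact Or.inl h
  · exact Or.inl rfl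

theorem viaVertices_edge_left_le (g : G) (x : X.set) (s t : Set.Ioo (0 : ℝ) 1) (q : Cay X) :
    viaVertices (edge g x s) q ≤ |(s : ℝ) - t| + viaVertices (edge g x t) q := by
  obtain ⟨j, k, h⟩ := exists_viaVertices (edge g x t) q
  have h1 := viaVertices_le (edge g x s) q j k
  have h2 := le_abs_self ((s : ℝ) - t)
  have h3 := neg_abs_le ((s : ℝ) - t)
  cases j <;> simp only [endpoint, offset] at h h1 <;> linarith

theorem cayDist_comm_le (p q : Cay X) : cayDist p q ≤ cayDist q p := by
  rcases cayDist_cases q p with h | ⟨g, x, s, t, rfl, rfl, h⟩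
  · rw [h]
    exact (cayDist_le_viaVertices p q).trans (viaVertices_comm_le p q)
  · rw [h, abs_sub_comm]
    exact cayDist_le_abs g x t s

theorem cayDist_self (p : Cay X) : cayDist p p = 0 := by
  apply le_antisymm
  · rcases p with g | ⟨g, x, s⟩
    · refine (cayDist_le_viaVertices _ _).trans ((viaVertices_le _ _ false false).trans ?_)
      simp [endpoint, offset, wordDist_self]
    · simpa using cayDist_le_abs g x s s
  · rcases cayDist_cases p p with h | ⟨g, x, s, t, -, -, h⟩
    · obtain ⟨j, k, h'⟩ := exists_viaVertices p p
      rw [h, h']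
      have := offset_nonneg p j
      have := offset_nonneg p k
      have := wordDist_nonneg X (endpoint p j) (endpoint p k)
      linarith
    · rw [h]
      exact abs_nonneg _

theorem cayDist_triangle (p q r : Cay X) : cayDist p r ≤ cayDist p q + cayDist q r := by
  rcases cayDist_cases p q with h | ⟨g, x, s, t, rfl, rfl, h⟩
  · rcases cayDist_cases q r with h' | ⟨g', x', s', t', rfl, rfl, h'⟩
    · rw [h, h']
      exact (cayDist_le_viaVertices p r).trans (viaVertices_triangle p q r)
    · rw [h, h']
      have h1 := cayDist_le_viaVertices p (edge g' x' t')
      have h2 := viaVertices_comm_le p (edge g' x' t')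
      have h3 := viaVertices_edge_left_le g' x' t' s' p
      have h4 := viaVertices_comm_le (edge g' x' s') p
      rw [abs_sub_comm] at h3
      linarith
  · rcases cayDist_cases (edge g x t) r with h' | ⟨g', x', s', t', hq, rfl, h'⟩
    · rw [h, h']
      exact (cayDist_le_viaVertices _ r).trans (viaVertices_edge_left_le g x s t r)
    · rw [h, h']
      injection hq with h1 h2 h3
      subst h1 h2 h3
      exact (cayDist_le_abs g x s t').trans (abs_sub_le _ _ _)

theorem eq_of_cayDist_eq_zero {p q : Cay X} (h : cayDist p q = 0) : p = q := by
  rcases cayDist_cases p q with h' | ⟨g, x, s, t, rfl, rfl, h'⟩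
  · obtain ⟨j, k, h''⟩ := exists_viaVertices p q
    have h1 := offset_nonneg p j
    have h2 := offset_nonneg q k
    have h3 := wordDist_nonneg X (endpoint p j) (endpoint q k)
    have h4 : offset p j = 0 := by linarith
    have h5 : offset q k = 0 := by linarith
    have h6 : wordDist X (endpoint p j) (endpoint q k) = 0 := by linarith
    have key : ∀ (p : Cay X) (j : Bool), offset p j = 0 → p = vertex (endpoint p j) := by
      rintro (g | ⟨g, x, t, ht0, ht1⟩) j hj
      · rfl
      · cases j <;> simp only [offset] at hj <;> exfalso <;> linarith
    rw [key p j h4, key q k h5]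
    have h7 : wordLength X ((endpoint p j)⁻¹ * endpoint q k) = 0 := by
      unfold wordDist at h6
      exact_mod_cast h6
    rw [inv_mul_eq_one.1 (eq_one_of_wordLength_eq_zero h7)]
  · rw [h] at h'
    have : (s : ℝ) = t := sub_eq_zero.1 (abs_eq_zero.1 h'.symm)
    rw [Subtype.ext this]

instance : MetricSpace (Cay X) where
  dist := cayDist
  dist_self := cayDist_self
  dist_comm p q := le_antisymm (cayDist_comm_le p q) (cayDist_comm_le q p)
  dist_triangle := cayDist_triangle
  eq_of_dist_eq_zero := eq_of_cayDist_eq_zero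

/-- The action of `G` on its Cayley graph by left multiplication. -/
instance : MulAction G (Cay X) where
  smul f
    | vertex g => vertex (f * g)
    | edge g x t => edge (f * g) x t
  one_smul := by
    rintro (g | ⟨g, x, t⟩)
    · exact congrArg vertex (one_mul g)
    · exact congrArg (fun h => edge h x t) (one_mul g)
  mul_smul := by
    rintro a b (g | ⟨g, x, t⟩)
    · exact congrArg vertex (mul_assoc a b g)
    · exact congrArg (fun h => edge h x t) (mul_assoc a b g)

theorem endpoint_smul (f : G) (p : Cay X) (k : Bool) : endpoint (f • p) k = f * endpoint p k := by
  rcases p with g | ⟨g, x, t⟩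
  · rfl
  · cases k
    · rfl
    · exact mul_assoc f g x

theorem offset_smul (f : G) (p : Cay X) (k : Bool) : offset (f • p) k = offset p k := by
  rcases p with g | ⟨g, x, t⟩
  · rfl
  · cases k <;> rfl

theorem viaVertices_smul (f : G) (p q : Cay X) :
    viaVertices (f • p) (f • q) = viaVertices p q := by
  simp only [viaVertices, endpoint_smul, offset_smul, wordDist_mul_left]

theorem cayDist_smul_le (f : G) (p q : Cay X) : cayDist (f • p) (f • q) ≤ cayDist p q := by
  rcases cayDist_cases p q with h | ⟨g, x, s, t, rfl, rfl, h⟩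
  · rw [h, ← viaVertices_smul f p q]
    exact cayDist_le_viaVertices _ _
  · rw [h]
    exact cayDist_le_abs (f * g) x s t

instance : IsIsometricSMul G (Cay X) where
  isometry_smul f := by
    refine Isometry.of_dist_eq fun p q => le_antisymm (cayDist_smul_le f p q) ?_
    have := cayDist_smul_le f⁻¹ (f • p) (f • q)
    rwa [inv_smul_smul, inv_smul_smul] at this

end Cay

end Cayley

/-! ### Hyperbolic generating sets and hyperbolic pseudo-length functions -/

section Subsets

variable (G : Type u) [Group G]

/-- `Hyp(G)`. -/
def Hyp : Set (Gen G) := {X | IsHyperbolic (Cay X)}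

/-- `Hyp_gt(G)`: the Cayley graph is hyperbolic, its boundary is infinite, and `G` does not fix any
boundary point. -/
def HypGt : Set (Gen G) :=
  {X | IsHyperbolic (Cay X) ∧ Infinite (Boundary (Cay X)) ∧ ¬ FixesBoundaryPoint G (Cay X)}

/-- `HypPL(G)`: pseudo-length functions of the form `g ↦ d_S(s, gs)` for an isometric action of
`G` on a hyperbolic space `S`. -/
def HypPL : Set (PL G) :=
  {l | ∃ (S : Type u) (_ : MetricSpace S) (_ : MulAction G S) (_ : IsIsometricSMul G S) (s : S),
    IsHyperbolic S ∧ ∀ g : G, l.1 g = dist s (g • s)}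

/-- `HypPL_gt(G)`: the same with actions of general type. -/
def HypPLGt : Set (PL G) :=
  {l | ∃ (S : Type u) (_ : MetricSpace S) (_ : MulAction G S) (_ : IsIsometricSMul G S) (s : S),
    IsHyperbolic S ∧ IsGeneralType G S ∧ ∀ g : G, l.1 g = dist s (g • s)}

end Subsets

end HypAct

end

open HypAct

noncomputable section

universe u

namespace HypAct

/-! ### Gromov products -/

section GromovProduct

variable {S : Type u} [MetricSpace S]

/-! Each set in question is rewritten as a condition on a length function `l` using only countable
quantifiers over `G` and `ℕ` and inequalities between values of `l`; such conditions are Borel. On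
the generating-set side, `{X | |g|_X ≤ n}` is open, so `wordPL` is Borel. It also reflects
domination, because a nontrivial element has word length at least 1 and an additive constant can be
absorbed. `Gen G` is Polish as a countable intersection of open sets in `2^G`, `PL G` as a closed
subset of `ℝ^G`.

Hyperbolicity. In a geodesic space the four-point condition implies slim and thin triangles, so it
suffices to test the four-point condition, and on an orbit this is a condition on `l`. The Cayley
graph is geodesic and the orbit of its base vertex is 1-dense, so the condition passes back to the
graph (`mem_hyp_iff`). For an arbitrary `l` satisfying the condition a space has to be built: the
injective hull of the pseudo-metric `l (x⁻¹ * y)` is geodesic, satisfies the four-point condition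
with the same constant, and carries an isometric action realizing `l` (`mem_hypPL_iff`).

General type. The definition quantifies over boundary points, an uncountable set. It is replaced by
`MovesEndpoints`, which quantifies over group elements only. An infinite limit set gives two orbit
sequences with distinct limits, and from them a loxodromic `a`. A finite invariant set of boundary
points contains only endpoints of `a`, and if `G` preserves the pair of endpoints then the limit set
lies in that pair. Hence general type means exactly that the endpoints are suitably moved
(`isGeneralType_iff`). Convergence of powers can be read off from `l`. -/

theorem gromovProduct_comm (x y z : S) : gromovProduct x y z = gromovProduct y x z := by
  unfold gromovProduct
  rw [dist_comm x y]
  ring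

theorem gromovProduct_nonneg (x y z : S) : 0 ≤ gromovProduct x y z := by
  unfold gromovProduct
  linarith [dist_triangle_right x y z]

theorem gromovProduct_self (x z : S) : gromovProduct x x z = dist x z := by
  simp [gromovProduct]

theorem gromovProduct_le_left (x y z : S) : gromovProduct x y z ≤ dist x z := by
  unfold gromovProduct
  linarith [dist_triangle_left y z x]

theorem gromovProduct_le_right (x y z : S) : gromovProduct x y z ≤ dist y z := by
  rw [gromovProduct_comm]
  exact gromovProduct_le_left y x z

theorem gromovProduct_add_swap (x y z : S) :
    gromovProduct x y z + gromovProduct x z y = dist y z := by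
  unfold gromovProduct
  rw [dist_comm z y]
  ring

theorem gromovProduct_base_le (x y o o' : S) :
    gromovProduct x y o ≤ gromovProduct x y o' + dist o o' := by
  unfold gromovProduct
  linarith [dist_triangle_right x o o', dist_triangle_right y o o']

theorem gromovProduct_left_le (x x' y o : S) :
    gromovProduct x y o ≤ gromovProduct x' y o + dist x x' := by
  unfold gromovProduct
  linarith [dist_triangle x x' o, dist_triangle_left x' y x]

theorem gromovProduct_right_le (x y y' o : S) :
    gromovProduct x y o ≤ gromovProduct x y' o + dist y y' := by
  rw [gromovProduct_comm x y, gromovProduct_comm x y']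
  exact gromovProduct_left_le y y' x o

/-- Up to `δ`, the smallest of three products at a common base point is attained twice. A small
product therefore stays small when one entry is replaced by a point having a large product with it.
-/
theorem FourPoint.le_of_le_of_lt {δ t : ℝ} (h : FourPoint S δ) {x y z o : S}
    (hxz : gromovProduct x z o ≤ t) (hxy : t + δ < gromovProduct x y o) :
    gromovProduct y z o ≤ t + δ := by
  have := h x y z o
  rcases min_choice (gromovProduct x y o) (gromovProduct y z o) with hm | hm <;> rw [hm] at this <;>
    linarith

theorem FourPoint.chain_le {δ t : ℝ} (hδ : 0 ≤ δ) (h : FourPoint S δ) {x x' z z' o : S}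
    (hxz : gromovProduct x z o ≤ t) (hx : t + 2 * δ < gromovProduct x x' o)
    (hz : t + 2 * δ < gromovProduct z z' o) : gromovProduct x' z' o ≤ t + 2 * δ := by
  have h1 := h.le_of_le_of_lt hxz (y := x') (by linarith)
  rw [gromovProduct_comm] at h1
  have h2 := h.le_of_le_of_lt h1 (y := z') (by linarith)
  rw [gromovProduct_comm] at h2
  linarith

end GromovProduct

/-! ### Sequences converging to infinity -/

section Sequences

variable {S : Type u} [MetricSpace S]

/-- Moving the base point changes a product by at most the distance moved, so one base point
decides. -/
theorem productTendsToInfinity_iff (o : S) (x y : ℕ → S) : ProductTendsToInfinity x y ↔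
    ∀ t : ℝ, ∃ N : ℕ, ∀ m ≥ N, ∀ n ≥ N, t ≤ gromovProduct (x m) (y n) o := by
  have key : ∀ o : S, Tendsto (fun p : ℕ × ℕ => gromovProduct (x p.1) (y p.2) o)
      (atTop ×ˢ atTop) atTop ↔
      ∀ t : ℝ, ∃ N : ℕ, ∀ m ≥ N, ∀ n ≥ N, t ≤ gromovProduct (x m) (y n) o := by
    intro o
    rw [prod_atTop_atTop_eq, tendsto_atTop]
    refine forall_congr' fun t => ?_
    rw [eventually_atTop]
    constructor
    · rintro ⟨⟨a, b⟩, hab⟩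
      exact ⟨max a b, fun m hm n hn => hab (m, n)
        ⟨(le_max_left a b).trans hm, (le_max_right a b).trans hn⟩⟩
    · rintro ⟨N, hN⟩
      exact ⟨(N, N), fun p hp => hN p.1 hp.1 p.2 hp.2⟩
  refine ⟨fun h => (key o).1 (h o), fun h o' => (key o').2 fun t => ?_⟩
  obtain ⟨N, hN⟩ := h (t + dist o o')
  refine ⟨N, fun m hm n hn => ?_⟩
  linarith [hN m hm n hn, gromovProduct_base_le (x m) (y n) o o']

theorem ProductTendsToInfinity.symm {x y : ℕ → S} (h : ProductTendsToInfinity x y) :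
    ProductTendsToInfinity y x := by
  rw [productTendsToInfinity_iff (x 0)] at h ⊢
  intro t
  obtain ⟨N, hN⟩ := h t
  refine ⟨N, fun m hm n hn => ?_⟩
  rw [gromovProduct_comm]
  exact hN n hn m hm

theorem ProductTendsToInfinity.trans {δ : ℝ} (hδ : FourPoint S δ) {x y z : ℕ → S}
    (h : ProductTendsToInfinity x y) (h' : ProductTendsToInfinity y z) :
    ProductTendsToInfinity x z := by
  rw [productTendsToInfinity_iff (x 0)] at h h' ⊢
  intro t
  obtain ⟨N, hN⟩ := h (t + δ)
  obtain ⟨N', hN'⟩ := h' (t + δ)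
  refine ⟨max N N', fun m hm n hn => ?_⟩
  have h1 := hN m ((le_max_left _ _).trans hm) (max N N') (le_max_left _ _)
  have h2 := hN' (max N N') (le_max_right _ _) n ((le_max_right _ _).trans hn)
  have h3 := hδ (x m) (y (max N N')) (z n) (x 0)
  have h4 := le_min h1 h2
  linarith

theorem ProductTendsToInfinity.of_dist_le {x y x' : ℕ → S} (h : ProductTendsToInfinity x y)
    {C : ℝ} (hC : ∀ n, dist (x n) (x' n) ≤ C) : ProductTendsToInfinity x' y := by
  rw [productTendsToInfinity_iff (x 0)] at h ⊢
  intro t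
  obtain ⟨N, hN⟩ := h (t + C)
  refine ⟨N, fun m hm n hn => ?_⟩
  linarith [hN m hm n hn, gromovProduct_left_le (x m) (x' m) (y n) (x 0), hC m]

/-- Two sequences converging to distinct boundary points have bounded Gromov products. -/
theorem exists_gromovProduct_le {δ : ℝ} (hδ0 : 0 ≤ δ) (hδ : FourPoint S δ) (o : S) {x y : ℕ → S}
    (hx : ProductTendsToInfinity x x) (hy : ProductTendsToInfinity y y)
    (h : ¬ ProductTendsToInfinity x y) :
    ∃ M : ℝ, 0 ≤ M ∧ ∃ N : ℕ, ∀ m ≥ N, ∀ n ≥ N, gromovProduct (x m) (y n) o ≤ M := by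
  rw [productTendsToInfinity_iff o] at h hx hy
  push Not at h
  obtain ⟨t, ht⟩ := h
  obtain ⟨N, hN⟩ := hx (t + 2 * δ + 1)
  obtain ⟨N', hN'⟩ := hy (t + 2 * δ + 1)
  obtain ⟨m, hm, n, hn, hmn⟩ := ht (max N N')
  have ht0 : 0 ≤ t := (gromovProduct_nonneg _ _ _).trans hmn.le
  -- A single late pair with product below `t` controls all late pairs: each entry is exchanged
  -- within its own sequence, at a cost of `δ` per exchange.
  refine ⟨t + 2 * δ, by linarith, max N N', fun k hk l hl => ?_⟩
  refine hδ.chain_le hδ0 hmn.le ?_ ?_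
  · linarith [hN m ((le_max_left _ _).trans hm) k ((le_max_left _ _).trans hk)]
  · linarith [hN' n ((le_max_right _ _).trans hn) l ((le_max_right _ _).trans hl)]

/-- The four-point condition makes the defining relation transitive, so the equivalence relation it
generates is the relation itself. -/
theorem boundary_mk_eq_iff {δ : ℝ} (hδ : FourPoint S δ) (x y : SeqToInfinity S) :
    (Quot.mk _ x : Boundary S) = Quot.mk _ y ↔ ProductTendsToInfinity x.1 y.1 := by
  refine ⟨fun h => ?_, fun h => Quot.sound h⟩
  have h' := Quot.eqvGen_exact h
  clear h
  induction h' with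
  | rel _ _ h => exact h
  | refl x => exact x.2
  | symm _ _ _ ih => exact ih.symm
  | trans _ _ _ _ _ ih ih' =>
    exact ih.trans hδ ih'

end Sequences

/-! ### Local-to-global principle -/

section LocalToGlobal

variable {S : Type u} [MetricSpace S] {δ M : ℝ} {x : ℕ → S}

/-- Local-to-global induction: small backtracking at `x n` and a long step make the product of `x 0`
and `x n` at `x (n + 1)` large. Since the product of `x n` and `x (n + 2)` there is at most `M`,
that of `x 0` and `x (n + 2)` is at most `M + δ`. -/
theorem gromovProduct_first_le (hδ : FourPoint S δ) (hδ0 : 0 ≤ δ)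
    (hM : ∀ n, gromovProduct (x n) (x (n + 2)) (x (n + 1)) ≤ M)
    (hL : ∀ n, 2 * M + 4 * δ + 1 ≤ dist (x n) (x (n + 1))) (n : ℕ) :
    gromovProduct (x 0) (x (n + 1)) (x n) ≤ M + δ := by
  have hM0 : 0 ≤ M := (gromovProduct_nonneg _ _ _).trans (hM 0)
  induction n with
  | zero =>
    refine (gromovProduct_le_left _ _ _).trans ?_
    rw [dist_self]
    linarith
  | succ n ih =>
    have h1 := gromovProduct_add_swap (x 0) (x (n + 1)) (x n)
    have h2 := hL n
    rw [dist_comm] at h2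
    have h3 := hδ.le_of_le_of_lt (y := x 0) (hM n)
      (by rw [gromovProduct_comm]; linarith)
    exact h3

/-- Each step gains its length minus twice the backtracking, at least `(2M + 4δ + 1) - 2(M + δ) ≥
1`. -/
theorem dist_first_ge (hδ : FourPoint S δ) (hδ0 : 0 ≤ δ)
    (hM : ∀ n, gromovProduct (x n) (x (n + 2)) (x (n + 1)) ≤ M)
    (hL : ∀ n, 2 * M + 4 * δ + 1 ≤ dist (x n) (x (n + 1))) (n : ℕ) :
    (n : ℝ) ≤ dist (x 0) (x n) := by
  induction n with
  | zero => simp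
  | succ n ih =>
    have h1 := gromovProduct_first_le hδ hδ0 hM hL n
    have h2 := hL n
    unfold gromovProduct at h1
    rw [dist_comm (x (n + 1)) (x n)] at h1
    push_cast
    linarith

end LocalToGlobal

/-! ### Loxodromic elements -/

section Loxodromic

variable {S : Type u} [MetricSpace S] {G : Type u} [Group G] [MulAction G S] [IsIsometricSMul G S]
variable {δ M : ℝ} {s : S}

theorem dist_smul_eq (a b : G) (s : S) : dist (a • s) (b • s) = dist s ((a⁻¹ * b) • s) := by
  rw [← dist_smul a⁻¹, inv_smul_smul, smul_smul]

theorem gromovProduct_smul_eq (a b c : G) (s : S) :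
    gromovProduct (a • s) (b • s) (c • s) =
      gromovProduct ((c⁻¹ * a) • s) ((c⁻¹ * b) • s) s := by
  rw [← gromovProduct_smul c⁻¹, inv_smul_smul, smul_smul, smul_smul]

/-- This is the local-to-global principle for `x n = a ^ n • s`, translated back to `s` by `a⁻¹ ^
n`; by invariance all local data equal those at `s`. -/
theorem gromovProduct_inv_pow_left_le (hδ : FourPoint S δ) (hδ0 : 0 ≤ δ) {a : G}
    (hM : gromovProduct (a • s) (a⁻¹ • s) s ≤ M) (hL : 2 * M + 4 * δ + 1 ≤ dist s (a • s)) (n : ℕ) :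
    gromovProduct ((a⁻¹ ^ n) • s) (a • s) s ≤ M + δ ∧ (n : ℝ) ≤ dist s ((a ^ n) • s) := by
  have hM' : ∀ n : ℕ, gromovProduct ((a ^ n) • s) ((a ^ (n + 2)) • s) ((a ^ (n + 1)) • s) ≤ M := by
    intro n
    rw [gromovProduct_smul_eq, gromovProduct_comm]
    convert hM using 3 <;> rw [inv_mul_eq_iff_eq_mul] <;> group
  have hL' : ∀ n : ℕ, 2 * M + 4 * δ + 1 ≤ dist ((a ^ n) • s) ((a ^ (n + 1)) • s) := by
    intro n
    rw [dist_smul_eq]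
    convert hL using 3
    rw [inv_mul_eq_iff_eq_mul, pow_succ]
  constructor
  · have := gromovProduct_first_le (x := fun n => (a ^ n) • s) hδ hδ0 hM' hL' n
    rw [gromovProduct_smul_eq] at this
    convert this using 3
    · simp
    · rw [eq_inv_mul_iff_mul_eq, pow_succ]
  · simpa using dist_first_ge (x := fun n => (a ^ n) • s) hδ hδ0 hM' hL' n

theorem gromovProduct_pow_inv_pow_le (hδ : FourPoint S δ) (hδ0 : 0 ≤ δ) {a : G}
    (hM : gromovProduct (a • s) (a⁻¹ • s) s ≤ M) (hL : 2 * M + 4 * δ + 1 ≤ dist s (a • s))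
    (m k : ℕ) : gromovProduct ((a⁻¹ ^ m) • s) ((a ^ k) • s) s ≤ M + 2 * δ := by
  have hM0 : 0 ≤ M := (gromovProduct_nonneg _ _ _).trans hM
  have h1 := (gromovProduct_inv_pow_left_le hδ hδ0 hM hL m).1
  cases k with
  | zero =>
    refine (gromovProduct_le_right _ _ _).trans ?_
    simp
    linarith
  | succ k =>
    have hM' : gromovProduct (a⁻¹ • s) (a⁻¹⁻¹ • s) s ≤ M := by
      rwa [gromovProduct_comm, inv_inv]
    have hL' : 2 * M + 4 * δ + 1 ≤ dist s (a⁻¹ • s) := by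
      rwa [← dist_smul a, smul_inv_smul, dist_comm]
    have h2 := (gromovProduct_inv_pow_left_le hδ hδ0 hM' hL' k).1
    rw [inv_inv] at h2
    have h4 : gromovProduct ((a ^ (k + 1)) • s) s (a • s) =
        gromovProduct ((a ^ k) • s) (a⁻¹ • s) s := by
      rw [← gromovProduct_smul a⁻¹, inv_smul_smul, smul_smul, pow_succ', inv_mul_cancel_left]
    rw [gromovProduct_comm] at h1
    -- By `h2` and `h4`, the point `a ^ (k + 1) • s` has a large product with `a • s`, which it may
    -- therefore replace in `h1`.
    have h5 := hδ.le_of_le_of_lt (y := (a ^ (k + 1)) • s) h1 (by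
      have h6 := gromovProduct_add_swap ((a ^ (k + 1)) • s) s (a • s)
      rw [gromovProduct_comm (a • s)]
      linarith)
    rw [gromovProduct_comm]
    linarith

theorem productTendsToInfinity_pow (hδ : FourPoint S δ) (hδ0 : 0 ≤ δ) {a : G}
    (hM : gromovProduct (a • s) (a⁻¹ • s) s ≤ M) (hL : 2 * M + 4 * δ + 1 ≤ dist s (a • s)) :
    ProductTendsToInfinity (fun n : ℕ => (a ^ n) • s) (fun n : ℕ => (a ^ n) • s) := by
  -- The product of `a ^ m • s` and `a ^ (m + k) • s` at `s` is the distance from `s` to `a ^ m •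
  -- s`, at least `m`, minus the bounded product of `a⁻¹ ^ m • s` and `a ^ k • s`.
  have key : ∀ m n : ℕ, m ≤ n →
      m - M - 2 * δ ≤ gromovProduct ((a ^ m) • s) ((a ^ n) • s) s := by
    intro m n hmn
    obtain ⟨k, rfl⟩ := Nat.exists_eq_add_of_le hmn
    have h1 := gromovProduct_pow_inv_pow_le hδ hδ0 hM hL m k
    have h2 := (gromovProduct_inv_pow_left_le hδ hδ0 hM hL m).2
    have h3 := gromovProduct_add_swap ((a ^ (m + k)) • s) s ((a ^ m) • s)
    have h4 : gromovProduct ((a⁻¹ ^ m) • s) ((a ^ k) • s) s =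
        gromovProduct ((a ^ (m + k)) • s) s ((a ^ m) • s) := by
      rw [← gromovProduct_smul (a ^ m), smul_smul, smul_smul, pow_add, inv_pow, mul_inv_cancel,
        one_smul, gromovProduct_comm]
    rw [gromovProduct_comm]
    linarith
  rw [productTendsToInfinity_iff s]
  intro t
  obtain ⟨N, hN⟩ := exists_nat_ge (t + M + 2 * δ)
  refine ⟨N, fun m hm n hn => ?_⟩
  have hm' : (N : ℝ) ≤ m := by exact_mod_cast hm
  have hn' : (N : ℝ) ≤ n := by exact_mod_cast hn
  rcases le_total m n with h | h
  · linarith [key m n h]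
  · rw [gromovProduct_comm]
    linarith [key n m h]

/-- The orbit map along the powers of `a` converges to two distinct boundary points. -/
def IsLoxodromic (a : G) (s : S) : Prop :=
  ProductTendsToInfinity (fun n : ℕ => (a ^ n) • s) (fun n : ℕ => (a ^ n) • s) ∧
  ProductTendsToInfinity (fun n : ℕ => (a⁻¹ ^ n) • s) (fun n : ℕ => (a⁻¹ ^ n) • s) ∧
  ¬ ProductTendsToInfinity (fun n : ℕ => (a ^ n) • s) (fun n : ℕ => (a⁻¹ ^ n) • s)

theorem isLoxodromic_of_gromovProduct_le (hδ : FourPoint S δ) (hδ0 : 0 ≤ δ) {a : G}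
    (hM : gromovProduct (a • s) (a⁻¹ • s) s ≤ M) (hL : 2 * M + 4 * δ + 1 ≤ dist s (a • s)) :
    IsLoxodromic a s := by
  refine ⟨productTendsToInfinity_pow hδ hδ0 hM hL, productTendsToInfinity_pow (M := M) hδ hδ0
    (by rwa [gromovProduct_comm, inv_inv]) (by rwa [← dist_smul a, smul_inv_smul, dist_comm]), ?_⟩
  rw [productTendsToInfinity_iff s]
  intro h
  obtain ⟨N, hN⟩ := h (M + 2 * δ + 1)
  have h1 := hN N le_rfl N le_rfl
  have h2 := gromovProduct_pow_inv_pow_le hδ hδ0 hM hL N N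
  rw [gromovProduct_comm] at h2
  linarith

theorem dist_tendsto_of_productTendsToInfinity {x : ℕ → S} (h : ProductTendsToInfinity x x) (o : S)
    (t : ℝ) : ∃ N : ℕ, ∀ n ≥ N, t ≤ dist (x n) o := by
  obtain ⟨N, hN⟩ := (productTendsToInfinity_iff o x x).1 h t
  exact ⟨N, fun n hn => by simpa [gromovProduct_self] using hN n hn n hn⟩

/-- Orbit sequences converging to two distinct boundary points yield a loxodromic element. -/
theorem exists_isLoxodromic (hδ : FourPoint S δ) (hδ0 : 0 ≤ δ) {g h : ℕ → G}
    (hg : ProductTendsToInfinity (fun n => g n • s) (fun n => g n • s))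
    (hh : ProductTendsToInfinity (fun n => h n • s) (fun n => h n • s))
    (hgh : ¬ ProductTendsToInfinity (fun n => g n • s) (fun n => h n • s)) :
    ∃ a : G, IsLoxodromic a s := by
  by_contra hne
  push Not at hne
  -- Without loxodromics the criterion fails for every element, so every `a • s` and `a⁻¹ • s` share
  -- almost half of the displacement of `a`. This is refuted for a product `a * b` of long elements
  -- pointing in different directions.
  have big : ∀ a : G, dist s (a • s) / 2 - 2 * δ - 1 < gromovProduct (a • s) (a⁻¹ • s) s := by
    intro a
    by_contra hcon
    push Not at hcon
    exact hne a (isLoxodromic_of_gromovProduct_le hδ hδ0 hcon (by linarith))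
  obtain ⟨M, hM0, N, hN⟩ := exists_gromovProduct_le hδ0 hδ s hg hh hgh
  obtain ⟨N₁, hN₁⟩ := dist_tendsto_of_productTendsToInfinity hg s (2 * M + 20 * δ + 20)
  obtain ⟨N₂, hN₂⟩ := dist_tendsto_of_productTendsToInfinity hh s (2 * M + 20 * δ + 20)
  set a := g (max N N₁)
  set b := h (max N N₂)
  have hab : gromovProduct (a • s) (b • s) s ≤ M := hN _ (le_max_left _ _) _ (le_max_left _ _)
  have ha : 2 * M + 20 * δ + 20 ≤ dist s (a • s) := by
    rw [dist_comm]; exact hN₁ _ (le_max_right _ _)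
  have hb : 2 * M + 20 * δ + 20 ≤ dist s (b • s) := by
    rw [dist_comm]; exact hN₂ _ (le_max_right _ _)
  have h1 : gromovProduct (a⁻¹ • s) (b • s) s ≤ M + δ :=
    hδ.le_of_le_of_lt hab (by linarith [big a])
  have h2 : gromovProduct (b⁻¹ • s) (a • s) s ≤ M + δ := by
    rw [gromovProduct_comm] at hab
    exact hδ.le_of_le_of_lt hab (by linarith [big b])
  have h3 : dist s (a • s) - M - δ ≤ gromovProduct (a • s) ((a * b) • s) s := by
    have := gromovProduct_add_swap ((a * b) • s) s (a • s)
    rw [← gromovProduct_smul a⁻¹, inv_smul_smul, smul_smul, inv_mul_cancel_left,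
      gromovProduct_comm] at this
    rw [gromovProduct_comm]
    linarith
  have h4 : dist s (b • s) - M - δ ≤ gromovProduct (b⁻¹ • s) ((a * b)⁻¹ • s) s := by
    have := gromovProduct_add_swap ((a * b)⁻¹ • s) s (b⁻¹ • s)
    rw [← gromovProduct_smul b, smul_inv_smul, smul_smul, mul_inv_rev, mul_inv_cancel_left,
      ← dist_smul b s (b⁻¹ • s), smul_inv_smul, dist_comm (b • s)] at this
    rw [gromovProduct_comm, mul_inv_rev]
    linarith
  -- `(a * b) • s` follows `a • s`, and `(a * b)⁻¹ • s` follows `b⁻¹ • s`, while the latter two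
  -- diverge. So this product is bounded, although `a * b` has displacement almost the sum of those
  -- of `a` and `b`.
  have h5 : gromovProduct ((a * b)⁻¹ • s) ((a * b) • s) s ≤ M + δ + 2 * δ :=
    hδ.chain_le hδ0 h2 (by linarith) (by linarith)
  have h6 := big (a * b)
  have h7 : dist s ((a * b) • s) =
      dist s (a • s) + dist s (b • s) - 2 * gromovProduct (a⁻¹ • s) (b • s) s := by
    unfold gromovProduct
    rw [← dist_smul a (a⁻¹ • s) s, ← dist_smul a (a⁻¹ • s) (b • s), smul_inv_smul, smul_smul,
      dist_comm (b • s)]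
    ring
  rw [gromovProduct_comm] at h6
  linarith

/-- If neither endpoint of a loxodromic `a` is represented by `y`, then no large power of `a` fixes
the boundary point represented by `y`. -/
theorem not_productTendsToInfinity_pow_smul (hδ : FourPoint S δ) (hδ0 : 0 ≤ δ) {a : G}
    (ha : IsLoxodromic a s) {y : ℕ → S} (hy : ProductTendsToInfinity y y)
    (h1 : ¬ ProductTendsToInfinity y (fun n : ℕ => (a ^ n) • s))
    (h2 : ¬ ProductTendsToInfinity y (fun n : ℕ => (a⁻¹ ^ n) • s)) :
    ∃ N : ℕ, ∀ n ≥ N, ¬ ProductTendsToInfinity y (fun k => (a ^ n) • y k) := by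
  obtain ⟨M, hM0, N, hN⟩ := exists_gromovProduct_le hδ0 hδ s hy ha.1 h1
  obtain ⟨M', hM0', N', hN'⟩ := exists_gromovProduct_le hδ0 hδ s hy ha.2.1 h2
  obtain ⟨K, hK⟩ := dist_tendsto_of_productTendsToInfinity ha.1 s (M + M' + δ + 1)
  refine ⟨max (max N N') K, fun n hn hcon => ?_⟩
  rw [productTendsToInfinity_iff s] at hcon
  obtain ⟨k, hk⟩ := hcon (M + δ + 1)
  have hk' := hk (max (max N N') k) (le_max_right _ _) (max (max N N') k) (le_max_right _ _)
  set z := y (max (max N N') k)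
  have hnN : N ≤ n := (le_max_left _ _).trans ((le_max_left _ _).trans hn)
  have hnN' : N' ≤ n := (le_max_right _ _).trans ((le_max_left _ _).trans hn)
  have h3 : gromovProduct z ((a ^ n) • s) s ≤ M :=
    hN _ ((le_max_left _ _).trans (le_max_left _ _)) _ hnN
  have h4 : gromovProduct z ((a⁻¹ ^ n) • s) s ≤ M' :=
    hN' _ ((le_max_right _ _).trans (le_max_left _ _)) _ hnN'
  -- By `h4` and `h6`, `a ^ n • z` has a large product with `a ^ n • s`, whereas `z` has a small one
  -- by `h3`. So `z` and `a ^ n • z` diverge.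
  have h5 := gromovProduct_add_swap ((a ^ n) • z) s ((a ^ n) • s)
  have h6 : gromovProduct ((a ^ n) • z) s ((a ^ n) • s) = gromovProduct z ((a⁻¹ ^ n) • s) s := by
    rw [← gromovProduct_smul (a ^ n) z, smul_smul, inv_pow, mul_inv_cancel, one_smul]
  have h7 := hK n ((le_max_right _ _).trans hn)
  rw [dist_comm] at h7
  rw [gromovProduct_comm] at h3
  have h8 := hδ.le_of_le_of_lt (y := (a ^ n) • z) h3 (by rw [gromovProduct_comm]; linarith)
  rw [gromovProduct_comm] at h8
  linarith

/-- If every element of `G` preserves the pair of endpoints of a loxodromic `a`, then the orbit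
accumulates only at these endpoints. -/
theorem tendsto_endpoint_of_preserved (hδ : FourPoint S δ) (hδ0 : 0 ≤ δ) {a : G}
    (ha : IsLoxodromic a s)
    (hinv : ∀ f : G,
      (ProductTendsToInfinity (fun n : ℕ => f • (a ^ n) • s) (fun n : ℕ => (a ^ n) • s) ∧
        ProductTendsToInfinity (fun n : ℕ => f • (a⁻¹ ^ n) • s) (fun n : ℕ => (a⁻¹ ^ n) • s)) ∨
      (ProductTendsToInfinity (fun n : ℕ => f • (a ^ n) • s) (fun n : ℕ => (a⁻¹ ^ n) • s) ∧
        ProductTendsToInfinity (fun n : ℕ => f • (a⁻¹ ^ n) • s) (fun n : ℕ => (a ^ n) • s)))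
    {f : ℕ → G} (hf : ProductTendsToInfinity (fun n => f n • s) (fun n => f n • s)) :
    ProductTendsToInfinity (fun n => f n • s) (fun n : ℕ => (a ^ n) • s) ∨
      ProductTendsToInfinity (fun n => f n • s) (fun n : ℕ => (a⁻¹ ^ n) • s) := by
  by_contra hcon
  push Not at hcon
  obtain ⟨M, hM0, N, hN⟩ := exists_gromovProduct_le hδ0 hδ s hf ha.1 hcon.1
  obtain ⟨M', hM0', N', hN'⟩ := exists_gromovProduct_le hδ0 hδ s hf ha.2.1 hcon.2
  obtain ⟨M₀, hM₀, N₀, hN₀⟩ := exists_gromovProduct_le hδ0 hδ s ha.1 ha.2.1 ha.2.2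
  obtain ⟨K, hK⟩ := dist_tendsto_of_productTendsToInfinity hf s (M + M' + M₀ + 2 * δ + 1)
  set i := max K (max N N')
  have hiN : N ≤ i := (le_max_left _ _).trans (le_max_right _ _)
  have hiN' : N' ≤ i := (le_max_right _ _).trans (le_max_right _ _)
  have hKi := hK i (le_max_left _ _)
  -- Since `f i` preserves the pair of endpoints, `f i • s` is about as close to the axis of `a` as
  -- `s` is: far-out powers in the two directions have a bounded product seen from `f i • s`.
  obtain ⟨n, hnN, hnN', hn⟩ : ∃ n : ℕ, N ≤ n ∧ N' ≤ n ∧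
      gromovProduct ((a ^ n) • s) ((a⁻¹ ^ n) • s) (f i • s) ≤ M₀ + 2 * δ := by
    rcases hinv (f i) with ⟨h1, h2⟩ | ⟨h1, h2⟩
    all_goals
      rw [productTendsToInfinity_iff (f i • s)] at h1 h2
      obtain ⟨K₁, hK₁⟩ := h1 (M₀ + 2 * δ + 1)
      obtain ⟨K₂, hK₂⟩ := h2 (M₀ + 2 * δ + 1)
      set n := max (max N N') (max N₀ (max K₁ K₂))
      have hn1 : K₁ ≤ n :=
        (le_max_left _ _).trans ((le_max_right _ _).trans (le_max_right _ _))
      have hn2 : K₂ ≤ n :=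
        (le_max_right _ _).trans ((le_max_right _ _).trans (le_max_right _ _))
      have hn0 : N₀ ≤ n := (le_max_left _ _).trans (le_max_right _ _)
      have h3 : gromovProduct (f i • (a ^ n) • s) (f i • (a⁻¹ ^ n) • s) (f i • s) ≤ M₀ := by
        rw [gromovProduct_smul]
        exact hN₀ n hn0 n hn0
      refine ⟨n, (le_max_left _ _).trans (le_max_left _ _),
        (le_max_right _ _).trans (le_max_left _ _), ?_⟩
      have h4 := hδ.chain_le hδ0 h3 ((lt_add_one _).trans_le (hK₁ n hn1 n hn1))
        ((lt_add_one _).trans_le (hK₂ n hn2 n hn2))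
    · exact h4
    · rwa [gromovProduct_comm]
  have h1 := hN i hiN n hnN
  have h2 := hN' i hiN' n hnN'
  have h3 := gromovProduct_nonneg ((a ^ n) • s) ((a⁻¹ ^ n) • s) s
  -- Summing, the mixed distances cancel and the distance from `f i • s` to `s` is at most `M + M' +
  -- M₀ + 2δ`, contradicting the choice of `i`.
  unfold gromovProduct at h1 h2 h3 hn
  rw [dist_comm (f i • s) ((a ^ n) • s)] at h1
  rw [dist_comm (f i • s) ((a⁻¹ ^ n) • s)] at h2
  linarith

end Loxodromic

/-! ### Limit sets -/

section LimitSet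

variable {S : Type u} [MetricSpace S] {G : Type u} [Group G] [MulAction G S] {δ : ℝ} {s : S}

/-- The boundary points represented by sequences in the orbit of `s`. -/
def orbitLimit (G : Type u) {S : Type u} [Group G] [MetricSpace S] [MulAction G S] (s : S) :
    Set (Boundary S) :=
  {ξ | ∃ (f : ℕ → G) (h : ProductTendsToInfinity (fun n => f n • s) (fun n => f n • s)),
    (Quot.mk _ (⟨fun n => f n • s, h⟩ : SeqToInfinity S) : Boundary S) = ξ}

theorem orbitLimit_subset_limitSet (hδ : FourPoint S δ) (s : S) :
    orbitLimit G s ⊆ limitSet G s := by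
  rintro _ ⟨f, h, rfl⟩
  refine mem_closure_iff.2 fun U hU hξ => ?_
  obtain ⟨t, ht⟩ := hU.2 _ hξ s
  obtain ⟨N, hN⟩ := (productTendsToInfinity_iff s _ _).1 h (t + 1 + δ)
  refine ⟨_, ht (Bordification.point (f N • s)) ?_, f N, rfl⟩
  -- The neighbourhood needs a strict inequality while infimum and liminf preserve only weak ones,
  -- hence the margin 1. The infimum also ranges over every representative `b`, each compared with
  -- the orbit sequence.
  refine lt_of_lt_of_le (b := ((t + 1 : ℝ) : EReal)) (by exact_mod_cast lt_add_one t) ?_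
  refine le_iInf fun a => le_iInf fun b => le_iInf fun ha => le_iInf fun hb => ?_
  obtain ⟨hb, hbξ⟩ := hb
  have hfb := ((boundary_mk_eq_iff hδ _ _).1 hbξ).symm
  obtain ⟨K, hK⟩ := (productTendsToInfinity_iff s _ _).1 hfb (t + 1 + δ)
  refine le_liminf_of_le (by isBoundedDefault) ?_
  have hev : ∀ᶠ k : ℕ × ℕ in atTop ×ˢ atTop, K ≤ k.2 :=
    tendsto_snd.eventually (eventually_ge_atTop K)
  filter_upwards [hev] with k hk
  have ha' : a k.1 = f N • s := ha k.1
  rw [ha']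
  have h1 := hN N le_rfl (max N K) (le_max_left _ _)
  have h2 := hK (max N K) (le_max_right _ _) k.2 hk
  have h3 := hδ (f N • s) (f (max N K) • s) (b k.2) s
  have h4 := le_min h1 h2
  have h5 : t + 1 ≤ gromovProduct (f N • s) (b k.2) s := by linarith
  exact_mod_cast h5

/-- Points outside the displayed set are adherent to the orbit or limits of orbit sequences, so an
orbit point can stand in for them. The loss of 1 pays for approximating an adherent point within
distance 1. -/
theorem exists_orbit_gromovProduct {b : ℕ → S} (hb : ProductTendsToInfinity b b) {o : S} {t : ℝ}
    {p : Bordification S} (hp : p ∉ {p : Bordification S | (∃ x ∉ closure (Set.range fun g : G =>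
      g • s), p = .point x) ∨ ∃ ξ ∉ orbitLimit G s, p = .infinity ξ})
    (ht : (t : EReal) < extGromovProduct p (.infinity (Quot.mk _ ⟨b, hb⟩)) o) :
    ∃ f : G, ∀ᶠ k in atTop, t - 1 ≤ gromovProduct (f • s) (b k) o := by
  rw [Set.mem_ofPred_eq, not_or] at hp
  have key : ∀ a : ℕ → S, Represents a p →
      ∀ᶠ k : ℕ × ℕ in atTop ×ˢ atTop, t < gromovProduct (a k.1) (b k.2) o := by
    intro a ha
    have h1 := ht.trans_le (iInf_le_of_le a (iInf_le_of_le b (iInf_le_of_le ha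
      (iInf_le_of_le ⟨hb, rfl⟩ le_rfl))))
    filter_upwards [eventually_lt_of_lt_liminf h1] with k hk
    exact_mod_cast hk
  cases p with
  | point x =>
    have hx : x ∈ closure (Set.range fun g : G => g • s) := by
      by_contra hx
      exact hp.1 ⟨x, hx, rfl⟩
    obtain ⟨_, ⟨f, rfl⟩, hf⟩ := Metric.mem_closure_iff.1 hx 1 one_pos
    refine ⟨f, ?_⟩
    obtain ⟨j, hj⟩ := (key (fun _ => x) fun _ => rfl).curry.exists
    filter_upwards [hj] with k hk
    linarith [gromovProduct_left_le x (f • s) (b k) o]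
  | infinity ξ =>
    have hξ : ξ ∈ orbitLimit G s := by
      by_contra hξ
      exact hp.2 ⟨ξ, hξ, rfl⟩
    obtain ⟨f, h, rfl⟩ := hξ
    obtain ⟨j, hj⟩ := (key (fun n => f n • s) ⟨h, rfl⟩).curry.exists
    refine ⟨f j, ?_⟩
    filter_upwards [hj] with k hk
    linarith

/-- The complement of the closed orbit together with its sequential limits is open: if every
neighbourhood of `η` left it, choosing an orbit point for each threshold `n` would give an orbit
sequence converging to `η`. This open set misses the orbit. -/
theorem limitSet_subset_orbitLimit (hδ : FourPoint S δ) (s : S) :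
    limitSet G s ⊆ orbitLimit G s := by
  intro ξ hξ
  by_contra hξ'
  set U : Set (Bordification S) := {p | (∃ x ∉ closure (Set.range fun g : G => g • s),
    p = .point x) ∨ ∃ ξ ∉ orbitLimit G s, p = .infinity ξ} with hU
  have hopen : IsOpen U := by
    constructor
    · have : {x : S | Bordification.point x ∈ U} = (closure (Set.range fun g : G => g • s))ᶜ := by
        ext x
        simp [hU]
      rw [this]
      exact isClosed_closure.isOpen_compl
    · intro η hη o
      have hη' : η ∉ orbitLimit G s := by
        rcases hη with ⟨x, -, h⟩ | ⟨ζ, hζ, h⟩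
        · cases h
        · cases h
          exact hζ
      by_contra hcon
      push Not at hcon
      apply hη'
      induction η using Quot.ind with
      | mk b =>
      obtain ⟨b, hb⟩ := b
      have hf : ∀ n : ℕ, ∃ f : G, ∀ᶠ k in atTop, (n : ℝ) - 1 ≤ gromovProduct (f • s) (b k) o := by
        intro n
        obtain ⟨p, hp, hpU⟩ := hcon n
        exact exists_orbit_gromovProduct hb hpU hp
      choose f hf using hf
      have hff : ProductTendsToInfinity (fun n => f n • s) b := by
        rw [productTendsToInfinity_iff o] at hb ⊢
        intro t
        obtain ⟨N, hN⟩ := hb (t + δ)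
        obtain ⟨K, hK⟩ := exists_nat_ge (t + δ + 1)
        refine ⟨max N K, fun m hm n hn => ?_⟩
        obtain ⟨k, hk, hkN⟩ := ((hf m).and (eventually_ge_atTop N)).exists
        have h1 := hN k hkN n ((le_max_left _ _).trans hn)
        have h2 : (K : ℝ) ≤ m := by exact_mod_cast (le_max_right _ _).trans hm
        have h3 := hδ (f m • s) (b k) (b n) o
        have h4 : t + δ ≤ min (gromovProduct (f m • s) (b k) o) (gromovProduct (b k) (b n) o) :=
          le_min (by linarith) h1
        linarith
      exact ⟨f, hff.trans hδ hff.symm, Quot.sound hff⟩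
  obtain ⟨_, hp, f, rfl⟩ := mem_closure_iff.1 hξ U hopen (Or.inr ⟨ξ, hξ', rfl⟩)
  rcases hp with ⟨x, hx, h⟩ | ⟨ζ, -, h⟩
  · cases h
    exact hx (subset_closure ⟨f, rfl⟩)
  · cases h

theorem limitSet_eq_orbitLimit (hδ : FourPoint S δ) (s : S) : limitSet G s = orbitLimit G s :=
  (limitSet_subset_orbitLimit hδ s).antisymm (orbitLimit_subset_limitSet hδ s)

end LimitSet

/-! ### General type actions -/

section GeneralType

variable {S : Type u} [MetricSpace S] {G : Type u} [Group G] [MulAction G S] [IsIsometricSMul G S]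
variable {δ : ℝ} {s : S}

theorem boundarySMul_mul (g h : G) (ξ : Boundary S) :
    boundarySMul (g * h) ξ = boundarySMul g (boundarySMul h ξ) := by
  induction ξ using Quot.ind with
  | mk x =>
    refine congrArg (Quot.mk _) (Subtype.ext (funext fun n => ?_))
    exact mul_smul g h (x.1 n)

theorem boundarySMul_one (ξ : Boundary S) : boundarySMul (1 : G) ξ = ξ := by
  induction ξ using Quot.ind with
  | mk x => exact congrArg (Quot.mk _) (Subtype.ext (funext fun n => one_smul G (x.1 n)))

theorem boundarySMul_injective (g : G) : Function.Injective (boundarySMul (S := S) g) := by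
  intro ξ η h
  rw [← boundarySMul_one (G := G) ξ, ← boundarySMul_one (G := G) η, ← inv_mul_cancel g,
    boundarySMul_mul, boundarySMul_mul, h]

theorem boundarySMul_mem_orbitLimit (g : G) {ξ : Boundary S} (hξ : ξ ∈ orbitLimit G s) :
    boundarySMul g ξ ∈ orbitLimit G s := by
  obtain ⟨f, h, rfl⟩ := hξ
  have h' := h.smul g
  simp only [smul_smul] at h'
  refine ⟨fun n => g * f n, h', congrArg (Quot.mk _) (Subtype.ext (funext fun n => ?_))⟩
  exact mul_smul g (f n) s

theorem orbitLimit_subset (s s' : S) : orbitLimit G s ⊆ orbitLimit G s' := by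
  rintro _ ⟨f, h, rfl⟩
  have hd : ∀ n, dist (f n • s) (f n • s') ≤ dist s s' := fun n => (dist_smul _ _ _).le
  have h1 := h.of_dist_le hd
  exact ⟨f, h1.symm.of_dist_le hd, Quot.sound h1⟩

theorem orbitLimit_eq (s s' : S) : orbitLimit G s = orbitLimit G s' :=
  (orbitLimit_subset s s').antisymm (orbitLimit_subset s' s)

/-- There is a loxodromic element whose attracting point is moved off both its endpoints by some
element of `G`, and whose repelling point is not fixed by `G`. -/
def MovesEndpoints (G : Type u) {S : Type u} [Group G] [MetricSpace S] [MulAction G S] (s : S) :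
    Prop :=
  ∃ a : G, IsLoxodromic a s ∧
    (∃ h : G,
      ¬ ProductTendsToInfinity (fun n : ℕ => (h * a ^ n) • s) (fun n : ℕ => (a ^ n) • s) ∧
      ¬ ProductTendsToInfinity (fun n : ℕ => (h * a ^ n) • s) (fun n : ℕ => (a⁻¹ ^ n) • s)) ∧
    ∃ h : G, ¬ ProductTendsToInfinity (fun n : ℕ => (h * a⁻¹ ^ n) • s) (fun n : ℕ => (a⁻¹ ^ n) • s)

/-- The boundary point represented by a sequence of powers. -/
def powLimit (a : G) (s : S)
    (h : ProductTendsToInfinity (fun n : ℕ => (a ^ n) • s) (fun n : ℕ => (a ^ n) • s)) :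
    Boundary S := Quot.mk _ ⟨_, h⟩

theorem boundarySMul_powLimit_eq_iff (hδ : FourPoint S δ) (h a b : G) (ha) (hb) :
    boundarySMul h (powLimit a s ha) = powLimit b s hb ↔
      ProductTendsToInfinity (fun n : ℕ => (h * a ^ n) • s) (fun n : ℕ => (b ^ n) • s) := by
  simp only [mul_smul]
  exact boundary_mk_eq_iff hδ ⟨_, _⟩ ⟨_, _⟩

theorem boundarySMul_pow_ne (hδ : FourPoint S δ) (hδ0 : 0 ≤ δ) {a : G} (ha : IsLoxodromic a s)
    {ξ : Boundary S} (h1 : ξ ≠ powLimit a s ha.1) (h2 : ξ ≠ powLimit a⁻¹ s ha.2.1) :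
    ∃ N : ℕ, ∀ n ≥ N, boundarySMul (a ^ n) ξ ≠ ξ := by
  induction ξ using Quot.ind with
  | mk y =>
    obtain ⟨N, hN⟩ := not_productTendsToInfinity_pow_smul hδ hδ0 ha y.2
      (fun h => h1 ((boundary_mk_eq_iff hδ _ _).2 h)) (fun h => h2 ((boundary_mk_eq_iff hδ _ _).2 h))
    exact ⟨N, fun n hn h => hN n hn ((boundary_mk_eq_iff hδ _ _).1 h).symm⟩

/-- Otherwise no large power of `a` fixes `ξ`, while finiteness of the invariant set makes two
translates of `ξ` by powers of `a` coincide. -/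
theorem eq_powLimit_of_finite (hδ : FourPoint S δ) (hδ0 : 0 ≤ δ) {a : G} (ha : IsLoxodromic a s)
    {F : Set (Boundary S)} (hF : F.Finite) (hinv : ∀ ξ ∈ F, ∀ g : G, boundarySMul g ξ ∈ F)
    {ξ : Boundary S} (hξ : ξ ∈ F) : ξ = powLimit a s ha.1 ∨ ξ = powLimit a⁻¹ s ha.2.1 := by
  by_contra hcon
  push Not at hcon
  obtain ⟨N, hN⟩ := boundarySMul_pow_ne hδ hδ0 ha hcon.1 hcon.2
  -- Multiples of `N + 1` are used so that the difference of two distinct exponents is at least `N`.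
  have hmaps : Set.MapsTo (fun j : ℕ => boundarySMul (a ^ (j * (N + 1))) ξ) Set.univ F :=
    fun j _ => hinv ξ hξ _
  obtain ⟨i, -, j, -, hij, heq⟩ := Set.infinite_univ.exists_lt_map_eq_of_mapsTo hmaps hF
  obtain ⟨k, rfl⟩ := Nat.exists_eq_add_of_lt hij
  have h1 : boundarySMul (a ^ (i * (N + 1))) (boundarySMul (a ^ ((k + 1) * (N + 1))) ξ) =
      boundarySMul (a ^ (i * (N + 1))) ξ := by
    rw [← boundarySMul_mul, ← pow_add, ← add_mul, ← add_assoc]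
    exact heq.symm
  refine hN ((k + 1) * (N + 1)) ?_ (boundarySMul_injective _ h1)
  nlinarith [Nat.zero_le (k * (N + 1))]

theorem MovesEndpoints.infinite_orbitLimit (hδ : FourPoint S δ) (hδ0 : 0 ≤ δ)
    (h : MovesEndpoints G s) : (orbitLimit G s).Infinite := by
  obtain ⟨a, ha, ⟨h, h1, h2⟩, -⟩ := h
  intro hfin
  have hmem : powLimit a s ha.1 ∈ orbitLimit G s := ⟨fun n => a ^ n, ha.1, rfl⟩
  rcases eq_powLimit_of_finite hδ hδ0 ha hfin (fun ξ hξ g => boundarySMul_mem_orbitLimit g hξ)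
    (boundarySMul_mem_orbitLimit h hmem) with h' | h'
  · exact h1 ((boundarySMul_powLimit_eq_iff hδ _ _ _ _ _).1 h')
  · exact h2 ((boundarySMul_powLimit_eq_iff hδ _ _ _ _ _).1 h')

theorem MovesEndpoints.not_fixesBoundaryPoint (hδ : FourPoint S δ) (hδ0 : 0 ≤ δ)
    (h : MovesEndpoints G s) : ¬ FixesBoundaryPoint G S := by
  obtain ⟨a, ha, ⟨h, h1, h2⟩, h', h3⟩ := h
  rintro ⟨ξ, hξ⟩
  rcases eq_powLimit_of_finite hδ hδ0 ha (Set.finite_singleton ξ)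
    (by rintro _ rfl g; exact hξ g) rfl with rfl | rfl
  · exact h1 ((boundarySMul_powLimit_eq_iff hδ _ _ _ _ _).1 (hξ h))
  · exact h3 ((boundarySMul_powLimit_eq_iff hδ _ _ _ _ _).1 (hξ h'))

/-- Elements act injectively on the boundary, so each one fixes or swaps the two endpoints, and the
orbit can accumulate nowhere else. -/
theorem orbitLimit_subset_of_preserved (hδ : FourPoint S δ) (hδ0 : 0 ≤ δ) {a : G}
    (ha : IsLoxodromic a s)
    (h1 : ∀ h : G, boundarySMul h (powLimit a s ha.1) ∈
      ({powLimit a s ha.1, powLimit a⁻¹ s ha.2.1} : Set (Boundary S)))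
    (h2 : ∀ h : G, boundarySMul h (powLimit a⁻¹ s ha.2.1) ∈
      ({powLimit a s ha.1, powLimit a⁻¹ s ha.2.1} : Set (Boundary S))) :
    orbitLimit G s ⊆ {powLimit a s ha.1, powLimit a⁻¹ s ha.2.1} := by
  have hne : powLimit a s ha.1 ≠ powLimit a⁻¹ s ha.2.1 := fun h =>
    ha.2.2 ((boundary_mk_eq_iff hδ ⟨_, ha.1⟩ ⟨_, ha.2.1⟩).1 h)
  rintro _ ⟨f, hf, rfl⟩
  have hinv : ∀ f : G,
      (ProductTendsToInfinity (fun n : ℕ => f • (a ^ n) • s) (fun n : ℕ => (a ^ n) • s) ∧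
        ProductTendsToInfinity (fun n : ℕ => f • (a⁻¹ ^ n) • s) (fun n : ℕ => (a⁻¹ ^ n) • s)) ∨
      (ProductTendsToInfinity (fun n : ℕ => f • (a ^ n) • s) (fun n : ℕ => (a⁻¹ ^ n) • s) ∧
        ProductTendsToInfinity (fun n : ℕ => f • (a⁻¹ ^ n) • s) (fun n : ℕ => (a ^ n) • s)) := by
    intro f
    simp only [smul_smul, ← boundarySMul_powLimit_eq_iff hδ f _ _ ha.1 ha.1,
      ← boundarySMul_powLimit_eq_iff hδ f _ _ ha.2.1 ha.1,
      ← boundarySMul_powLimit_eq_iff hδ f _ _ ha.1 ha.2.1,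
      ← boundarySMul_powLimit_eq_iff hδ f _ _ ha.2.1 ha.2.1]
    have h1f := h1 f
    have h2f := h2 f
    rw [Set.mem_insert_iff, Set.mem_singleton_iff] at h1f h2f
    rcases h1f with h | h <;> rcases h2f with h' | h'
    · exact (hne (boundarySMul_injective f (h.trans h'.symm))).elim
    · exact Or.inl ⟨h, h'⟩
    · exact Or.inr ⟨h, h'⟩
    · exact (hne (boundarySMul_injective f (h.trans h'.symm))).elim
  rcases tendsto_endpoint_of_preserved hδ hδ0 ha hinv hf with h | h
  · exact Or.inl (Quot.sound h)
  · exact Or.inr (Quot.sound h)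

theorem movesEndpoints_of_infinite (hδ : FourPoint S δ) (hδ0 : 0 ≤ δ)
    (hinf : (orbitLimit G s).Infinite) (hfix : ¬ FixesBoundaryPoint G S) : MovesEndpoints G s := by
  obtain ⟨_, ⟨g, hg, rfl⟩, _, ⟨h, hh, rfl⟩, hgh⟩ := hinf.nontrivial
  obtain ⟨a, ha⟩ := exists_isLoxodromic hδ hδ0 hg hh
    (fun h => hgh ((boundary_mk_eq_iff hδ _ _).2 h))
  have hnf : ∀ ξ : Boundary S, ∃ g : G, boundarySMul g ξ ≠ ξ := by
    intro ξ
    by_contra hcon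
    push Not at hcon
    exact hfix ⟨ξ, hcon⟩
  refine ⟨a, ha, ?_, ?_⟩
  · by_contra hcon
    have h1 : ∀ h : G, boundarySMul h (powLimit a s ha.1) ∈
        ({powLimit a s ha.1, powLimit a⁻¹ s ha.2.1} : Set (Boundary S)) := by
      intro h
      by_contra hh
      exact hcon ⟨h, fun h' => hh (Or.inl ((boundarySMul_powLimit_eq_iff hδ _ _ _ _ _).2 h')),
        fun h' => hh (Or.inr ((boundarySMul_powLimit_eq_iff hδ _ _ _ _ _).2 h'))⟩
    -- The attracting point is not fixed by `G`, so some `h₀` sends it to the repelling one. The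
    -- repelling point then also stays in the pair, and the limit set would be finite.
    obtain ⟨h₀, hh₀⟩ := hnf (powLimit a s ha.1)
    have hh₀' : boundarySMul h₀ (powLimit a s ha.1) = powLimit a⁻¹ s ha.2.1 :=
      (h1 h₀).resolve_left hh₀
    refine hinf ((Set.toFinite _).subset (orbitLimit_subset_of_preserved hδ hδ0 ha h1 fun h => ?_))
    rw [← hh₀', ← boundarySMul_mul, hh₀']
    exact h1 _
  · obtain ⟨h, hh⟩ := hnf (powLimit a⁻¹ s ha.2.1)
    exact ⟨h, fun h' => hh ((boundarySMul_powLimit_eq_iff hδ _ _ _ _ _).2 h')⟩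

theorem movesEndpoints_iff (hδ : FourPoint S δ) (hδ0 : 0 ≤ δ) :
    MovesEndpoints G s ↔ (orbitLimit G s).Infinite ∧ ¬ FixesBoundaryPoint G S :=
  ⟨fun h => ⟨h.infinite_orbitLimit hδ hδ0, h.not_fixesBoundaryPoint hδ hδ0⟩,
    fun h => movesEndpoints_of_infinite hδ hδ0 h.1 h.2⟩

theorem isGeneralType_iff (hδ : FourPoint S δ) (hδ0 : 0 ≤ δ) (s : S) :
    IsGeneralType G S ↔ MovesEndpoints G s := by
  rw [movesEndpoints_iff hδ hδ0, IsGeneralType]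
  simp only [limitSet_eq_orbitLimit hδ]
  refine and_congr_left fun _ => ⟨?_, fun h => ⟨s, h⟩⟩
  rintro ⟨s', h⟩
  rwa [orbitLimit_eq s s']

end GeneralType

/-! ### Geodesics -/

section Geodesic

variable {S : Type u} [MetricSpace S]

/-- There is a `1`-Lipschitz path of length `L` from `x` to `y`. -/
def LipPath (x y : S) (L : ℝ) : Prop :=
  0 ≤ L ∧ ∃ c : ℝ → S, c 0 = x ∧ c L = y ∧
    ∀ s ∈ Set.Icc 0 L, ∀ t ∈ Set.Icc 0 L, dist (c s) (c t) ≤ |s - t|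

theorem LipPath.refl (x : S) : LipPath x x 0 :=
  ⟨le_rfl, fun _ => x, rfl, rfl, fun s _ t _ => by simp⟩

theorem LipPath.symm {x y : S} {L : ℝ} (h : LipPath x y L) : LipPath y x L := by
  obtain ⟨hL, c, h0, h1, hc⟩ := h
  refine ⟨hL, fun t => c (L - t), by simpa using h1, by simpa using h0, fun s hs t ht => ?_⟩
  refine (hc (L - s) ⟨by linarith [hs.2], by linarith [hs.1]⟩ (L - t)
    ⟨by linarith [ht.2], by linarith [ht.1]⟩).trans (le_of_eq ?_)
  rw [abs_sub_comm]
  congr 1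
  ring

theorem LipPath.trans {x y z : S} {L L' : ℝ} (h : LipPath x y L) (h' : LipPath y z L') :
    LipPath x z (L + L') := by
  obtain ⟨hL, c, h0, h1, hc⟩ := h
  obtain ⟨hL', c', h0', h1', hc'⟩ := h'
  set d : ℝ → S := fun t => if t ≤ L then c t else c' (t - L) with hd
  have hmix : ∀ s t : ℝ, 0 ≤ s → s ≤ L → L < t → t ≤ L + L' → dist (d s) (d t) ≤ t - s := by
    intro s t hs0 hs ht ht'
    simp only [hd, if_pos hs, if_neg ht.not_ge]
    have e1 := hc s ⟨hs0, hs⟩ L ⟨hL, le_rfl⟩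
    have e2 := hc' 0 ⟨le_rfl, hL'⟩ (t - L) ⟨by linarith, by linarith⟩
    rw [abs_of_nonpos (by linarith)] at e1 e2
    rw [h1] at e1
    rw [h0'] at e2
    linarith [dist_triangle (c s) y (c' (t - L))]
  refine ⟨add_nonneg hL hL', d, ?_, ?_, fun s hs t ht => ?_⟩
  · simp [hd, hL, h0]
  · simp only [hd]
    split_ifs with h
    · have hL0 : L' = 0 := by linarith
      subst hL0
      rw [add_zero, h1, ← h0', h1']
    · rw [add_sub_cancel_left, h1']
  · rcases le_or_gt s L with h2 | h2 <;> rcases le_or_gt t L with h3 | h3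
    · simp only [hd, if_pos h2, if_pos h3]
      exact hc s ⟨hs.1, h2⟩ t ⟨ht.1, h3⟩
    · rw [abs_sub_comm]
      exact (hmix s t hs.1 h2 h3 ht.2).trans (le_abs_self _)
    · rw [dist_comm]
      exact (hmix t s ht.1 h3 h2 hs.2).trans (le_abs_self _)
    · simp only [hd, if_neg h2.not_ge, if_neg h3.not_ge]
      refine (hc' (s - L) ⟨by linarith, by linarith [hs.2]⟩ (t - L)
        ⟨by linarith, by linarith [ht.2]⟩).trans (le_of_eq ?_)
      congr 1
      ring

/-- A `1`-Lipschitz path of length `dist x y` is geodesic. -/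
theorem LipPath.exists_geodesic {x y : S} (h : LipPath x y (dist x y)) :
    ∃ A, IsGeodesicSegment x y A := by
  obtain ⟨hL, c, h0, h1, hc⟩ := h
  refine ⟨_, c, h0, h1, ?_, rfl⟩
  have key : ∀ s ∈ Set.Icc 0 (dist x y), ∀ t ∈ Set.Icc 0 (dist x y), s ≤ t →
      dist (c s) (c t) = |s - t| := by
    intro s hs t ht hst
    refine le_antisymm (hc s hs t ht) ?_
    have e1 := hc 0 ⟨le_rfl, hL⟩ s hs
    have e2 := hc t ht (dist x y) ⟨hL, le_rfl⟩
    rw [h0, abs_of_nonpos (by linarith [hs.1])] at e1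
    rw [h1, abs_of_nonpos (by linarith [ht.2])] at e2
    rw [abs_of_nonpos (by linarith)]
    -- The three pieces have lengths at most `s`, `t - s` and `dist x y - t`, whose sum is `dist x
    -- y`; none of them can be shorter.
    linarith [dist_triangle4 x (c s) (c t) y]
  intro s hs t ht
  rcases le_total s t with h | h
  · exact key s hs t ht h
  · rw [dist_comm, abs_sub_comm]
    exact key t ht s hs h

theorem IsGeodesicSegment.dist_add_dist {x y u : S} {A : Set S} (h : IsGeodesicSegment x y A)
    (hu : u ∈ A) : dist x u + dist u y = dist x y := by
  obtain ⟨c, h0, h1, hc, rfl⟩ := h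
  obtain ⟨t, ht, rfl⟩ := hu
  have e1 := hc 0 ⟨le_rfl, dist_nonneg⟩ t ht
  have e2 := hc t ht (dist x y) ⟨dist_nonneg, le_rfl⟩
  rw [h0, abs_of_nonpos (by linarith [ht.1])] at e1
  rw [h1, abs_of_nonpos (by linarith [ht.2])] at e2
  linarith

theorem IsGeodesicSegment.exists_mem {x y : S} {A : Set S} (h : IsGeodesicSegment x y A) {r : ℝ}
    (hr : 0 ≤ r) (hr' : r ≤ dist x y) : ∃ v ∈ A, dist x v = r := by
  obtain ⟨c, h0, h1, hc, rfl⟩ := h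
  refine ⟨c r, ⟨r, ⟨hr, hr'⟩, rfl⟩, ?_⟩
  have e1 := hc 0 ⟨le_rfl, dist_nonneg⟩ r ⟨hr, hr'⟩
  rw [h0, abs_of_nonpos (by linarith)] at e1
  linarith

/-- Two applications of the four-point condition along `u, x, y, v` give a product of `u` and `v` at
`z` of at least `dist u z - 2δ`. As both points are equally far from `z`, this bounds `dist u v` by
`4δ`. -/
theorem FourPoint.dist_conjugate_le {δ : ℝ} (hδ : FourPoint S δ) {x y z u v : S}
    (hu : dist x u + dist u z = dist x z) (hv : dist y v + dist v z = dist y z)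
    (huv : dist u z = dist v z) (h : dist u z ≤ gromovProduct x y z) : dist u v ≤ 4 * δ := by
  have h1 := hδ u x v z
  have h2 := hδ x y v z
  have e1 : gromovProduct u x z = dist u z := by
    unfold gromovProduct
    rw [dist_comm u x]
    linarith
  have e2 : gromovProduct y v z = dist u z := by
    unfold gromovProduct
    linarith
  have e3 : gromovProduct u v z = dist u z - dist u v / 2 := by
    unfold gromovProduct
    linarith
  rw [e2, min_eq_right h] at h2
  rw [e1, e3] at h1
  have hnn : δ ≥ 0 := by
    have := hδ z z z z
    simp [gromovProduct] at this
    exact this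
  have h3 : dist u z - δ ≤ min (dist u z) (gromovProduct x v z) := le_min (by linarith) h2
  linarith

theorem FourPoint.thinTriangles {δ : ℝ} (hδ : FourPoint S δ) : ThinTriangles S (4 * δ) := by
  intro x y z A B hA hB u hu v hv huv h
  exact hδ.dist_conjugate_le (hA.dist_add_dist hu) (hB.dist_add_dist hv) huv h

/-- The side from `x` to `y` splits at distance `gromovProduct y z x` from `x`; points on either
part are conjugate to points of one of the other sides. -/
theorem FourPoint.slimTriangles {δ : ℝ} (hδ : FourPoint S δ) : SlimTriangles S (4 * δ) := by
  intro x y z A B C hA hB hC u hu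
  have h1 := hA.dist_add_dist hu
  rcases le_or_gt (dist u x) (gromovProduct y z x) with h | h
  · obtain ⟨v, hv, hv'⟩ := hC.exists_mem (r := dist u x) dist_nonneg
      (h.trans (by rw [dist_comm]; exact gromovProduct_le_right _ _ _))
    have h2 := hC.dist_add_dist hv
    refine ⟨v, Or.inr hv, hδ.dist_conjugate_le (x := y) (y := z) (z := x) ?_ ?_ ?_ h⟩
    · linarith [dist_comm y u, dist_comm u x, dist_comm x y]
    · linarith [dist_comm z v, dist_comm v x, dist_comm x z]
    · rw [← hv', dist_comm]
  · have h' : dist u y ≤ gromovProduct x z y := by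
      have := gromovProduct_add_swap z x y
      rw [gromovProduct_comm z x, gromovProduct_comm z y] at this
      linarith [dist_comm u x]
    obtain ⟨v, hv, hv'⟩ := hB.exists_mem (r := dist u y) dist_nonneg
      (h'.trans (by rw [dist_comm]; exact gromovProduct_le_right _ _ _))
    have h2 := hB.dist_add_dist hv
    refine ⟨v, Or.inl hv, hδ.dist_conjugate_le (x := x) (y := z) (z := y) h1 ?_ ?_ h'⟩
    · linarith [dist_comm z v, dist_comm v y, dist_comm y z]
    · rw [← hv', dist_comm]

theorem FourPoint.mono {δ δ' : ℝ} (hδ : FourPoint S δ) (h : δ ≤ δ') : FourPoint S δ' :=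
  fun x y z t => by linarith [hδ x y z t]

theorem IsGeodesicSpace.isHyperbolic (hS : IsGeodesicSpace S) {δ : ℝ} (hδ0 : 0 ≤ δ)
    (hδ : FourPoint S δ) : IsHyperbolic S :=
  ⟨hS, 4 * δ, by positivity, hδ.slimTriangles, hδ.thinTriangles, hδ.mono (by linarith)⟩

end Geodesic

/-! ### The Cayley graph is geodesic -/

section CayleyGeodesic

variable {G : Type u} [Group G] {X : Gen G}

namespace Cay

theorem dist_le_viaVertices (p q : Cay X) (j k : Bool) : dist p q ≤
    offset p j + wordDist X (endpoint p j) (endpoint q k) + offset q k :=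
  (cayDist_le_viaVertices p q).trans (viaVertices_le p q j k)

theorem dist_vertex_vertex (g h : G) :
    dist (vertex g : Cay X) (vertex h) = wordDist X g h := by
  obtain ⟨j, k, hjk⟩ := exists_viaVertices (vertex g : Cay X) (vertex h)
  change viaVertices (vertex g : Cay X) (vertex h) = _
  rw [hjk]
  simp [offset, endpoint]

/-- The parametrization of the edge from `g` to `gx` by `[0, 1]`. -/
def edgePath (X : Gen G) (g : G) (x : X.set) (t : ℝ) : Cay X :=
  if h : t ∈ Set.Ioo (0 : ℝ) 1 then edge g x ⟨t, h⟩ else if t ≤ 0 then vertex g else vertex (g * x)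

theorem edgePath_of_mem (g : G) (x : X.set) (t : Set.Ioo (0 : ℝ) 1) :
    edgePath X g x t = edge g x t := by
  rw [edgePath, dif_pos t.2]

theorem edgePath_zero (g : G) (x : X.set) : edgePath X g x 0 = vertex g := by simp [edgePath]

theorem edgePath_one (g : G) (x : X.set) : edgePath X g x 1 = vertex (g * x) := by
  simp [edgePath]

theorem dist_edgePath_le (g : G) (x : X.set) {s t : ℝ} (hs : s ∈ Set.Icc (0 : ℝ) 1)
    (ht : t ∈ Set.Icc (0 : ℝ) 1) : dist (edgePath X g x s) (edgePath X g x t) ≤ |s - t| := by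
  have key : ∀ s ∈ Set.Icc (0 : ℝ) 1, ∀ t ∈ Set.Icc (0 : ℝ) 1, s ≤ t →
      dist (edgePath X g x s) (edgePath X g x t) ≤ |s - t| := by
    clear hs ht s t
    intro s hs t ht hst
    rcases hst.eq_or_lt with rfl | hst
    · simp
    rcases hs.1.eq_or_lt with rfl | hs0
    · rw [edgePath_zero, zero_sub, abs_neg, abs_of_nonneg ht.1]
      rcases ht.2.eq_or_lt with rfl | ht1
      · rw [edgePath_one, dist_vertex_vertex]
        exact wordDist_mul_gen_le X g x x.2
      · lift t to Set.Ioo (0 : ℝ) 1 using ⟨hst, ht1⟩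
        rw [edgePath_of_mem]
        simpa [offset, endpoint, wordDist_self] using
          dist_le_viaVertices (vertex g) (edge g x t) false false
    · lift s to Set.Ioo (0 : ℝ) 1 using ⟨hs0, hst.trans_le ht.2⟩
      rw [edgePath_of_mem]
      rcases ht.2.eq_or_lt with rfl | ht1
      · rw [edgePath_one, abs_sub_comm, abs_of_nonneg (by linarith)]
        simpa [offset, endpoint, wordDist_self] using
          dist_le_viaVertices (edge g x s) (vertex (g * x)) true true
      · lift t to Set.Ioo (0 : ℝ) 1 using ⟨hs0.trans hst, ht1⟩
        rw [edgePath_of_mem]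
        exact cayDist_le_abs g x s t
  rcases le_total s t with h | h
  · exact key s hs t ht h
  · rw [dist_comm, abs_sub_comm]
    exact key t ht s hs h

theorem lipPath_edgePath (g : G) (x : X.set) {s t : ℝ} (hs : 0 ≤ s) (hst : s ≤ t) (ht : t ≤ 1) :
    LipPath (edgePath X g x s) (edgePath X g x t) (t - s) := by
  refine ⟨by linarith, fun r => edgePath X g x (s + r), by simp, by simp, fun a ha b hb => ?_⟩
  refine (dist_edgePath_le g x ⟨by linarith [ha.1], by linarith [ha.2]⟩
    ⟨by linarith [hb.1], by linarith [hb.2]⟩).trans (le_of_eq ?_)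
  rw [add_sub_add_left_eq_sub]

theorem lipPath_endpoint (p : Cay X) (j : Bool) :
    LipPath p (vertex (endpoint p j)) (offset p j) := by
  rcases p with g | ⟨g, x, t⟩
  · exact LipPath.refl _
  · cases j
    · have := lipPath_edgePath g x le_rfl t.2.1.le t.2.2.le
      rw [edgePath_zero, edgePath_of_mem, sub_zero] at this
      exact this.symm
    · have := lipPath_edgePath g x t.2.1.le t.2.2.le le_rfl
      rw [edgePath_one, edgePath_of_mem] at this
      exact this

theorem lipPath_word (w : List G) (hw : ∀ a ∈ w, a ∈ X.set ∨ a⁻¹ ∈ X.set) (g : G) :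
    LipPath (vertex g : Cay X) (vertex (g * w.prod)) w.length := by
  induction w generalizing g with
  | nil => simpa using LipPath.refl _
  | cons a w ih =>
    have h1 : LipPath (vertex g : Cay X) (vertex (g * a)) 1 := by
      rcases hw a (by simp) with h | h
      · have := lipPath_edgePath g ⟨a, h⟩ le_rfl zero_le_one le_rfl
        rwa [edgePath_zero, edgePath_one, sub_zero] at this
      · have := lipPath_edgePath (g * a) ⟨a⁻¹, h⟩ le_rfl zero_le_one le_rfl
        rw [edgePath_zero, edgePath_one, sub_zero] at this
        simpa using this.symm
    have h2 := h1.trans (ih (fun b hb => hw b (by simp [hb])) (g * a))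
    rw [List.prod_cons, List.length_cons, ← mul_assoc]
    push_cast
    rwa [add_comm]

theorem lipPath_vertex (g h : G) : LipPath (vertex g : Cay X) (vertex h) (wordDist X g h) := by
  obtain ⟨w, hlen, hw, hprod⟩ := isWordOfLength_wordLength X (g⁻¹ * h)
  have := lipPath_word w hw g
  rwa [hprod, mul_inv_cancel_left, hlen] at this

/-- Each formula defining the distance is the length of an explicit path, either inside one edge or
along a shortest word between endpoints. A 1-Lipschitz path as long as the distance is geodesic. -/
theorem isGeodesicSpace (X : Gen G) : IsGeodesicSpace (Cay X) := by
  intro p q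
  apply LipPath.exists_geodesic
  have hd : dist p q = cayDist p q := rfl
  rcases cayDist_cases p q with h | ⟨g, x, s, t, rfl, rfl, h⟩
  · obtain ⟨j, k, hjk⟩ := exists_viaVertices p q
    rw [hd, h, hjk]
    exact ((lipPath_endpoint p j).trans (lipPath_vertex _ _)).trans (lipPath_endpoint q k).symm
  · rw [hd, h]
    rcases le_total (s : ℝ) t with hst | hst
    · have := lipPath_edgePath g x s.2.1.le hst t.2.2.le
      rw [edgePath_of_mem, edgePath_of_mem] at this
      rwa [abs_sub_comm, abs_of_nonneg (sub_nonneg.2 hst)]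
    · have := (lipPath_edgePath g x t.2.1.le hst s.2.2.le).symm
      rw [edgePath_of_mem, edgePath_of_mem] at this
      rwa [abs_of_nonneg (sub_nonneg.2 hst)]

theorem smul_vertex (f g : G) : f • (vertex g : Cay X) = vertex (f * g) := rfl

theorem dist_base_le (p : Cay X) : dist p (endpoint p false • vertex 1) ≤ 1 := by
  rw [smul_vertex, mul_one]
  refine (dist_le_viaVertices p _ false false).trans ?_
  rcases p with g | ⟨g, x, t⟩
  · simp [offset, endpoint, wordDist_self]
  · simpa [offset, endpoint, wordDist_self] using t.2.2.le

theorem dist_base (g : G) : dist (vertex 1 : Cay X) (g • vertex 1) = (wordPL X).1 g := by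
  rw [smul_vertex, dist_vertex_vertex, wordDist]
  simp [wordPL]

/-- Every point is within 1 of the orbit of the base vertex, so any boundary sequence can be moved
into the orbit. -/
theorem orbitLimit_base (X : Gen G) : orbitLimit G (vertex 1 : Cay X) = Set.univ := by
  refine Set.eq_univ_of_forall fun ξ => ?_
  induction ξ using Quot.ind with
  | mk y =>
    obtain ⟨y, hy⟩ := y
    have h1 := hy.of_dist_le fun n => dist_base_le (y n)
    exact ⟨fun n => endpoint (y n) false, h1.symm.of_dist_le fun n => dist_base_le (y n),
      Quot.sound h1⟩

end Cay

end CayleyGeodesic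

/-! ### Hyperbolicity of pseudo-length functions -/

section LengthProducts

variable {G : Type u} [Group G]

/-- The Gromov product at the identity for the pseudo-metric `(g, h) ↦ l (g⁻¹h)`. -/
def lengthProduct (l : G → ℝ) (x y : G) : ℝ := (l x + l y - l (x⁻¹ * y)) / 2

/-- The four-point condition at the identity. -/
def LengthFourPoint (l : G → ℝ) (δ : ℝ) : Prop :=
  ∀ x y z : G, min (lengthProduct l x y) (lengthProduct l y z) - δ ≤ lengthProduct l x z

/-- The products `(x_m, y_n)` tend to infinity. -/
def LengthTends (l : G → ℝ) (x y : ℕ → G) : Prop :=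
  ∀ t : ℕ, ∃ N : ℕ, ∀ m ≥ N, ∀ n ≥ N, (t : ℝ) ≤ lengthProduct l (x m) (y n)

/-- The condition `MovesEndpoints` in terms of the pseudo-length function. -/
def LengthMovesEndpoints (l : G → ℝ) : Prop :=
  ∃ a : G, (LengthTends l (fun n => a ^ n) (fun n => a ^ n) ∧
      LengthTends l (fun n => a⁻¹ ^ n) (fun n => a⁻¹ ^ n) ∧
      ¬ LengthTends l (fun n => a ^ n) (fun n => a⁻¹ ^ n)) ∧
    (∃ h : G, ¬ LengthTends l (fun n => h * a ^ n) (fun n => a ^ n) ∧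
      ¬ LengthTends l (fun n => h * a ^ n) (fun n => a⁻¹ ^ n)) ∧
    ∃ h : G, ¬ LengthTends l (fun n => h * a⁻¹ ^ n) (fun n => a⁻¹ ^ n)

variable {S : Type u} [MetricSpace S] [MulAction G S] [IsIsometricSMul G S] {s : S} {l : G → ℝ}

theorem lengthProduct_eq (hl : ∀ g, l g = dist s (g • s)) (x y : G) :
    lengthProduct l x y = gromovProduct (x • s) (y • s) s := by
  rw [lengthProduct, gromovProduct, hl, hl, hl, ← dist_smul_eq, dist_comm s, dist_comm s]

theorem lengthTends_iff (hl : ∀ g, l g = dist s (g • s)) (x y : ℕ → G) :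
    LengthTends l x y ↔ ProductTendsToInfinity (fun n => x n • s) (fun n => y n • s) := by
  rw [productTendsToInfinity_iff s]
  simp only [LengthTends, lengthProduct_eq hl]
  refine ⟨fun h t => ?_, fun h t => h t⟩
  obtain ⟨k, hk⟩ := exists_nat_ge t
  obtain ⟨N, hN⟩ := h k
  exact ⟨N, fun m hm n hn => hk.trans (hN m hm n hn)⟩

theorem lengthMovesEndpoints_iff (hl : ∀ g, l g = dist s (g • s)) :
    LengthMovesEndpoints l ↔ MovesEndpoints G s := by
  simp only [LengthMovesEndpoints, MovesEndpoints, IsLoxodromic, lengthTends_iff hl]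

theorem FourPoint.lengthFourPoint {δ : ℝ} (hδ : FourPoint S δ) (hl : ∀ g, l g = dist s (g • s)) :
    LengthFourPoint l δ := by
  intro x y z
  simp only [lengthProduct_eq hl]
  exact hδ _ _ _ _

/-- If the orbit of `s` is `1`-dense, the four-point condition passes from `G` to the space. -/
theorem LengthFourPoint.fourPoint {δ : ℝ} (h : LengthFourPoint l δ)
    (hl : ∀ g, l g = dist s (g • s)) (hs : ∀ p : S, ∃ g : G, dist p (g • s) ≤ 1) :
    FourPoint S (δ + 6) := by
  -- Each of the three points moved costs at most 1. The bound is used on both sides of the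
  -- inequality, hence the constant 6.
  have close : ∀ x y o x' y' o' : S, dist x x' ≤ 1 → dist y y' ≤ 1 → dist o o' ≤ 1 →
      gromovProduct x y o ≤ gromovProduct x' y' o' + 3 := by
    intro x y o x' y' o' hx hy ho
    linarith [gromovProduct_left_le x x' y o, gromovProduct_right_le x' y y' o,
      gromovProduct_base_le x' y' o o']
  intro x y z t
  obtain ⟨a, ha⟩ := hs x
  obtain ⟨b, hb⟩ := hs y
  obtain ⟨c, hc⟩ := hs z
  obtain ⟨d, hd⟩ := hs t
  have h1 := h (d⁻¹ * a) (d⁻¹ * b) (d⁻¹ * c)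
  simp only [lengthProduct_eq hl, ← gromovProduct_smul_eq] at h1
  have h2 := close x y t _ _ _ ha hb hd
  have h3 := close y z t _ _ _ hb hc hd
  have h4 := close (a • s) (c • s) (d • s) x z t (by rwa [dist_comm]) (by rwa [dist_comm])
    (by rwa [dist_comm])
  have h5 : min (gromovProduct x y t) (gromovProduct y z t) - 3 ≤
      min (gromovProduct (a • s) (b • s) (d • s)) (gromovProduct (b • s) (c • s) (d • s)) :=
    le_min (by linarith [min_le_left (gromovProduct x y t) (gromovProduct y z t)])
      (by linarith [min_le_right (gromovProduct x y t) (gromovProduct y z t)])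
  linarith

theorem LengthFourPoint.mono {δ δ' : ℝ} (h : LengthFourPoint l δ) (hδ : δ ≤ δ') :
    LengthFourPoint l δ' := fun x y z => by linarith [h x y z]

theorem mem_hyp_iff (X : Gen G) : X ∈ Hyp G ↔ ∃ n : ℕ, LengthFourPoint (wordPL X).1 n := by
  constructor
  · rintro ⟨-, δ, -, -, -, hδ⟩
    obtain ⟨n, hn⟩ := exists_nat_ge δ
    exact ⟨n, (hδ.lengthFourPoint fun g => (Cay.dist_base g).symm).mono hn⟩
  · rintro ⟨n, hn⟩
    exact (Cay.isGeodesicSpace X).isHyperbolic (by positivity)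
      (hn.fourPoint (fun g => (Cay.dist_base g).symm) fun p => ⟨_, Cay.dist_base_le p⟩)

theorem mem_hypGt_iff (X : Gen G) :
    X ∈ HypGt G ↔ X ∈ Hyp G ∧ LengthMovesEndpoints (wordPL X).1 := by
  refine and_congr_right fun hX => ?_
  obtain ⟨-, δ, hδ0, -, -, hδ⟩ := hX
  rw [lengthMovesEndpoints_iff fun g => (Cay.dist_base g).symm, movesEndpoints_iff hδ hδ0,
    Cay.orbitLimit_base, Set.infinite_univ_iff]

end LengthProducts

/-! ### The injective hull of a pseudo-length function -/

section Hull

variable {G : Type u} [Group G]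

/-- The left invariant pseudo-metric of a pseudo-length function. -/
def PL.pdist (l : PL G) (x y : G) : ℝ := l.1 (x⁻¹ * y)

namespace PL

variable (l : PL G)

theorem pdist_self (x : G) : l.pdist x x = 0 := by simp [pdist, l.2.one]

theorem pdist_comm (x y : G) : l.pdist x y = l.pdist y x := by
  rw [pdist, l.2.inv, pdist]
  simp

theorem pdist_triangle (x y z : G) : l.pdist x z ≤ l.pdist x y + l.pdist y z := by
  have := l.2.mul_le (x⁻¹ * y) (y⁻¹ * z)
  rwa [show x⁻¹ * y * (y⁻¹ * z) = x⁻¹ * z by group] at this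

theorem pdist_mul_left (g x y : G) : l.pdist (g * x) (g * y) = l.pdist x y := by
  rw [pdist, pdist]
  group

/-- Functions `f` with `d(x, y) ≤ f x + f y`. -/
def Admissible (f : G → ℝ) : Prop := ∀ x y, l.pdist x y ≤ f x + f y

/-- Admissible functions `f` with `f x = sup_y (d(x, y) - f y)`. -/
def Extremal (f : G → ℝ) : Prop :=
  l.Admissible f ∧ ∀ x, ∀ ε > 0, ∃ y, f x ≤ l.pdist x y - f y + ε

/-- The function `x ↦ sup_y (d(x, y) - f y)`. -/
def conj (f : G → ℝ) (x : G) : ℝ := ⨆ y, (l.pdist x y - f y)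

variable {l} {f g : G → ℝ}

theorem Admissible.nonneg (hf : l.Admissible f) (x : G) : 0 ≤ f x := by
  have := hf x x
  rw [pdist_self] at this
  linarith

theorem Admissible.bddAbove (hf : l.Admissible f) (x : G) :
    BddAbove (Set.range fun y => l.pdist x y - f y) :=
  ⟨f x, by rintro _ ⟨y, rfl⟩; linarith [hf x y]⟩

theorem Admissible.conj_le (hf : l.Admissible f) (x : G) : l.conj f x ≤ f x :=
  ciSup_le fun y => by linarith [hf x y]

theorem Admissible.le_conj (hf : l.Admissible f) (x y : G) : l.pdist x y - f y ≤ l.conj f x :=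
  le_ciSup (hf.bddAbove x) y

theorem Extremal.conj_eq (hf : l.Extremal f) : l.conj f = f := by
  funext x
  refine le_antisymm (hf.1.conj_le x) (le_of_forall_pos_le_add fun ε hε => ?_)
  obtain ⟨y, hy⟩ := hf.2 x ε hε
  linarith [hf.1.le_conj x y]

theorem Admissible.extremal (hf : l.Admissible f) (h : ∀ x, f x ≤ l.conj f x) : l.Extremal f := by
  refine ⟨hf, fun x ε hε => ?_⟩
  obtain ⟨y, hy⟩ := exists_lt_of_lt_ciSup (sub_lt_self (l.conj f x) hε)
  exact ⟨y, by linarith [h x]⟩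

theorem Admissible.conj_le_add (hg : l.Admissible g) {C : ℝ}
    (h : ∀ x, |f x - g x| ≤ C) (x : G) : l.conj f x ≤ l.conj g x + C :=
  ciSup_le fun y => by linarith [hg.le_conj x y, neg_le_of_abs_le (h y)]

variable (l) in
/-- The average of `f` and `conj f`. -/
def average (f : G → ℝ) (x : G) : ℝ := (f x + l.conj f x) / 2

/-- Both `d(x, y) ≤ f y + conj f x` and `d(x, y) ≤ f x + conj f y` hold; their mean is the claim. -/
theorem Admissible.average (hf : l.Admissible f) : l.Admissible (l.average f) := by
  intro x y
  have h1 := hf.le_conj x y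
  have h2 := hf.le_conj y x
  rw [pdist_comm] at h2
  unfold PL.average
  linarith

theorem Admissible.average_le (hf : l.Admissible f) (x : G) : l.average f x ≤ f x := by
  unfold PL.average
  linarith [hf.conj_le x]

theorem Admissible.abs_average_sub_le (hf : l.Admissible f) (hg : l.Admissible g) {C : ℝ}
    (h : ∀ x, |f x - g x| ≤ C) (x : G) : |l.average f x - l.average g x| ≤ C := by
  have h1 := hg.conj_le_add h x
  have h2 := hf.conj_le_add (fun y => by rw [abs_sub_comm]; exact h y) x
  have h3 := abs_le.1 (h x)
  unfold PL.average
  rw [abs_le]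
  constructor <;> linarith [h3.1, h3.2]

variable (l) in
/-- The retraction of the admissible functions onto the extremal ones. -/
def retract (f : G → ℝ) (x : G) : ℝ := ⨅ n : ℕ, (l.average^[n] f) x

theorem Admissible.iterate (hf : l.Admissible f) (n : ℕ) : l.Admissible (l.average^[n] f) := by
  induction n with
  | zero => exact hf
  | succ n ih =>
    rw [Function.iterate_succ_apply']
    exact ih.average

theorem Admissible.antitone_iterate (hf : l.Admissible f) (x : G) :
    Antitone fun n : ℕ => (l.average^[n] f) x :=
  antitone_nat_of_succ_le fun n => by
    rw [Function.iterate_succ_apply']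
    exact (hf.iterate n).average_le x

theorem Admissible.bddBelow_iterate (hf : l.Admissible f) (x : G) :
    BddBelow (Set.range fun n : ℕ => (l.average^[n] f) x) :=
  ⟨0, by rintro _ ⟨n, rfl⟩; exact (hf.iterate n).nonneg x⟩

theorem Admissible.tendsto_iterate (hf : l.Admissible f) (x : G) :
    Tendsto (fun n : ℕ => (l.average^[n] f) x) atTop (𝓝 (l.retract f x)) :=
  tendsto_atTop_ciInf (hf.antitone_iterate x) (hf.bddBelow_iterate x)

theorem Admissible.retract_admissible (hf : l.Admissible f) : l.Admissible (l.retract f) :=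
  fun x y => ge_of_tendsto' ((hf.tendsto_iterate x).add (hf.tendsto_iterate y))
    fun n => hf.iterate n x y

/-- With `f_n` the iterates, `conj f_n = 2 f_{n+1} - f_n` converges to the limit function. Since
`conj` reverses order and the limit lies below `f_n`, each `conj f_n` is at most `conj` of the
limit. -/
theorem Admissible.retract_extremal (hf : l.Admissible f) : l.Extremal (l.retract f) := by
  refine hf.retract_admissible.extremal fun x => ?_
  have h1 : Tendsto (fun n : ℕ => 2 * (l.average^[n + 1] f) x - (l.average^[n] f) x) atTop
      (𝓝 (2 * l.retract f x - l.retract f x)) :=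
    (((tendsto_add_atTop_iff_nat 1).2 (hf.tendsto_iterate x)).const_mul 2).sub
      (hf.tendsto_iterate x)
  rw [show 2 * l.retract f x - l.retract f x = l.retract f x by ring] at h1
  refine le_of_tendsto' h1 fun n => ?_
  have h2 : 2 * (l.average^[n + 1] f) x - (l.average^[n] f) x = l.conj (l.average^[n] f) x := by
    rw [Function.iterate_succ_apply', PL.average]
    ring
  rw [h2]
  refine ciSup_le fun y => ?_
  have h3 : l.retract f y ≤ (l.average^[n] f) y := ciInf_le (hf.bddBelow_iterate y) n
  linarith [hf.retract_admissible.le_conj x y]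

theorem Extremal.retract_eq (hf : l.Extremal f) : l.retract f = f := by
  have h : ∀ n : ℕ, l.average^[n] f = f := fun n => by
    refine Function.iterate_fixed (funext fun x => ?_) n
    rw [PL.average, hf.conj_eq]
    ring
  funext x
  simp [retract, h]

theorem Admissible.abs_retract_sub_le (hf : l.Admissible f) (hg : l.Admissible g) {C : ℝ}
    (h : ∀ x, |f x - g x| ≤ C) (x : G) : |l.retract f x - l.retract g x| ≤ C := by
  have key : ∀ n : ℕ, ∀ x, |(l.average^[n] f) x - (l.average^[n] g) x| ≤ C := by
    intro n
    induction n with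
    | zero => exact h
    | succ n ih =>
      rw [Function.iterate_succ_apply', Function.iterate_succ_apply']
      exact (hf.iterate n).abs_average_sub_le (hg.iterate n) ih
  exact le_of_tendsto' ((hf.tendsto_iterate x).sub (hg.tendsto_iterate x)).abs fun n => key n x

theorem Extremal.le_pdist_add (hf : l.Extremal f) (x : G) : f x ≤ l.pdist x 1 + f 1 := by
  refine le_of_forall_pos_le_add fun ε hε => ?_
  obtain ⟨y, hy⟩ := hf.2 x ε hε
  linarith [l.pdist_triangle x 1 y, hf.1 1 y]

/-- This makes the sup distance on the hull meaningful, as a real supremum of an unbounded set is 0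
by default. -/
theorem Extremal.bddAbove_sub (hf : l.Extremal f) (hg : l.Extremal g) :
    BddAbove (Set.range fun x => |f x - g x|) := by
  refine ⟨f 1 + g 1, ?_⟩
  rintro _ ⟨x, rfl⟩
  have h1 := hf.le_pdist_add x
  have h2 := hg.le_pdist_add x
  have h3 := hf.1 x 1
  have h4 := hg.1 x 1
  rw [abs_le]
  constructor <;> linarith

variable (l) in
/-- The injective hull of the pseudo-metric space `(G, pdist)`. -/
def Hull : Type u := {f : G → ℝ // l.Extremal f}

namespace Hull

instance : Dist l.Hull := ⟨fun f g => ⨆ x, |f.1 x - g.1 x|⟩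

theorem abs_sub_le_dist (f g : l.Hull) (x : G) : |f.1 x - g.1 x| ≤ dist f g :=
  le_ciSup (f.2.bddAbove_sub g.2) x

theorem dist_le {f g : l.Hull} {C : ℝ} (h : ∀ x, |f.1 x - g.1 x| ≤ C) : dist f g ≤ C :=
  ciSup_le h

instance : MetricSpace l.Hull where
  dist_self f := by simp [dist]
  dist_comm f g := by simp only [dist, abs_sub_comm]
  dist_triangle f g h := dist_le fun x => (_root_.abs_sub_le _ (g.1 x) _).trans
    (add_le_add (abs_sub_le_dist f g x) (abs_sub_le_dist g h x))
  eq_of_dist_eq_zero {f g} h := Subtype.ext <| funext fun x => by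
    have := abs_sub_le_dist f g x
    rw [h] at this
    exact sub_eq_zero.1 (abs_eq_zero.1 (le_antisymm this (abs_nonneg _)))

theorem extremal_translate (h : G) {f : G → ℝ} (hf : l.Extremal f) :
    l.Extremal fun x => f (h⁻¹ * x) := by
  constructor
  · intro x y
    rw [← l.pdist_mul_left h⁻¹]
    exact hf.1 _ _
  · intro x ε hε
    obtain ⟨y, hy⟩ := hf.2 (h⁻¹ * x) ε hε
    refine ⟨h * y, ?_⟩
    rw [← l.pdist_mul_left h⁻¹]
    simpa only [inv_mul_cancel_left] using hy

instance : MulAction G l.Hull where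
  smul h f := ⟨fun x => f.1 (h⁻¹ * x), extremal_translate h f.2⟩
  one_smul f := Subtype.ext <| funext fun x => by
    change f.1 (1⁻¹ * x) = f.1 x
    simp
  mul_smul a b f := Subtype.ext <| funext fun x => by
    change f.1 ((a * b)⁻¹ * x) = f.1 (b⁻¹ * (a⁻¹ * x))
    rw [mul_inv_rev, mul_assoc]

theorem smul_apply (h : G) (f : l.Hull) (x : G) : (h • f).1 x = f.1 (h⁻¹ * x) := rfl

instance : IsIsometricSMul G l.Hull where
  isometry_smul h := Isometry.of_dist_eq fun f g =>
    (Equiv.mulLeft h⁻¹).iSup_comp (g := fun x => |f.1 x - g.1 x|)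

/-- The point of the hull corresponding to the identity of `G`. -/
def base (l : PL G) : l.Hull :=
  ⟨l.1, by
    constructor
    · intro x y
      have := l.2.mul_le x⁻¹ y
      rwa [← l.2.inv] at this
    · intro x ε hε
      refine ⟨1, ?_⟩
      rw [pdist_comm, pdist, l.2.one]
      simp [hε.le]⟩

theorem dist_base (g : G) : dist (base l) (g • base l) = l.1 g := by
  apply le_antisymm
  · refine dist_le fun x => ?_
    rw [smul_apply, abs_le]
    have h1 := l.2.mul_le g (g⁻¹ * x)
    have h2 := l.2.mul_le g⁻¹ x
    rw [mul_inv_cancel_left] at h1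
    rw [← l.2.inv] at h2
    constructor <;> simp only [base] <;> linarith
  · have := abs_sub_le_dist (base l) (g • base l) g
    rw [smul_apply, inv_mul_cancel] at this
    simpa [base, l.2.one, abs_of_nonneg (l.2.nonneg g)] using this

theorem pdist_sub_le_dist (f g : l.Hull) (a b : G) :
    l.pdist a b - f.1 a - g.1 b ≤ dist f g := by
  linarith [f.2.1 a b, le_abs_self (f.1 b - g.1 b), abs_sub_le_dist f g b]

/-- Distances in the hull are suprema of `d(a, b) - f a - g b`, which transfers metric inequalities
from `G` to the hull. -/
theorem exists_dist_le (f g : l.Hull) {ε : ℝ} (hε : 0 < ε) :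
    ∃ a b, dist f g ≤ l.pdist a b - f.1 a - g.1 b + ε := by
  obtain ⟨x, hx⟩ := exists_lt_of_lt_ciSup (sub_lt_self (dist f g) (half_pos hε))
  rcases abs_cases (f.1 x - g.1 x) with ⟨h, -⟩ | ⟨h, -⟩
  · obtain ⟨y, hy⟩ := f.2.2 x (ε / 2) (half_pos hε)
    refine ⟨y, x, ?_⟩
    rw [l.pdist_comm]
    linarith
  · obtain ⟨y, hy⟩ := g.2.2 x (ε / 2) (half_pos hε)
    exact ⟨x, y, by linarith⟩

theorem pdist_fourPoint {δ : ℝ} (h : LengthFourPoint l.1 δ) (x y z t : G) :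
    l.pdist x z + l.pdist y t ≤
      max (l.pdist x y + l.pdist z t) (l.pdist y z + l.pdist x t) + 2 * δ := by
  have h1 := h (t⁻¹ * x) (t⁻¹ * y) (t⁻¹ * z)
  have e : ∀ a b : G, lengthProduct l.1 (t⁻¹ * a) (t⁻¹ * b) =
      (l.pdist a t + l.pdist b t - l.pdist a b) / 2 := by
    intro a b
    rw [l.pdist_comm a t, l.pdist_comm b t]
    simp only [lengthProduct, PL.pdist]
    rw [show (t⁻¹ * a)⁻¹ * (t⁻¹ * b) = a⁻¹ * b by group]
  rw [e, e, e] at h1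
  rcases min_choice ((l.pdist x t + l.pdist y t - l.pdist x y) / 2)
    ((l.pdist y t + l.pdist z t - l.pdist y z) / 2) with hm | hm <;> rw [hm] at h1
  · linarith [le_max_left (l.pdist x y + l.pdist z t) (l.pdist y z + l.pdist x t)]
  · linarith [le_max_right (l.pdist x y + l.pdist z t) (l.pdist y z + l.pdist x t)]

theorem fourPoint {δ : ℝ} (h : LengthFourPoint l.1 δ) : FourPoint l.Hull δ := by
  intro x y z t
  suffices hs : dist x z + dist y t ≤
      max (dist x y + dist z t) (dist y z + dist x t) + 2 * δ by
    unfold gromovProduct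
    rcases max_choice (dist x y + dist z t) (dist y z + dist x t) with hm | hm <;> rw [hm] at hs
    · linarith [min_le_left ((dist x t + dist y t - dist x y) / 2)
        ((dist y t + dist z t - dist y z) / 2)]
    · linarith [min_le_right ((dist x t + dist y t - dist x y) / 2)
        ((dist y t + dist z t - dist y z) / 2)]
  refine le_of_forall_pos_le_add fun ε hε => ?_
  -- The correction terms `x a`, `y b`, `z c`, `t d` occur once in each of the three sums of
  -- distances, so they cancel and the constant `δ` is kept.
  obtain ⟨a, c, hac⟩ := exists_dist_le x z (half_pos hε)
  obtain ⟨b, d, hbd⟩ := exists_dist_le y t (half_pos hε)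
  have h1 := pdist_fourPoint h a b c d
  have h2 := pdist_sub_le_dist x y a b
  have h3 := pdist_sub_le_dist z t c d
  have h4 := pdist_sub_le_dist y z b c
  have h5 := pdist_sub_le_dist x t a d
  rcases max_choice (l.pdist a b + l.pdist c d) (l.pdist b c + l.pdist a d) with hm | hm <;>
    rw [hm] at h1
  · linarith [le_max_left (dist x y + dist z t) (dist y z + dist x t)]
  · linarith [le_max_right (dist x y + dist z t) (dist y z + dist x t)]

theorem admissible_segment (f g : l.Hull) {t : ℝ} (ht : t ∈ Set.Icc (0 : ℝ) 1) :
    l.Admissible fun x => (1 - t) * f.1 x + t * g.1 x := by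
  intro x y
  have h1 := mul_le_mul_of_nonneg_left (f.2.1 x y) (sub_nonneg.2 ht.2)
  have h2 := mul_le_mul_of_nonneg_left (g.2.1 x y) ht.1
  linarith

theorem isGeodesicSpace (l : PL G) : IsGeodesicSpace l.Hull := by
  intro f g
  apply LipPath.exists_geodesic
  -- The affine segment consists of admissible functions, and the retraction is nonexpanding and
  -- fixes its endpoints. Clamping defines the path for all real `t`; if `f = g`, division by 0
  -- gives 0, which is harmless.
  refine ⟨dist_nonneg, fun t => ⟨l.retract fun x =>
    (1 - (Set.projIcc (0 : ℝ) 1 zero_le_one (t / dist f g) : ℝ)) * f.1 x +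
      (Set.projIcc (0 : ℝ) 1 zero_le_one (t / dist f g) : ℝ) * g.1 x,
    (admissible_segment f g (Subtype.mem _)).retract_extremal⟩, ?_, ?_, ?_⟩
  · refine Subtype.ext ?_
    simp [f.2.retract_eq]
  · refine Subtype.ext ?_
    rcases eq_or_ne f g with rfl | h
    · simp [f.2.retract_eq]
    · simp [div_self (dist_ne_zero.2 h), g.2.retract_eq]
  · intro s hs t ht
    refine dist_le fun x => Admissible.abs_retract_sub_le (admissible_segment f g (Subtype.mem _))
      (admissible_segment f g (Subtype.mem _)) (fun y => ?_) x
    set a : ℝ := (Set.projIcc (0 : ℝ) 1 zero_le_one (s / dist f g) : ℝ)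
    set b : ℝ := (Set.projIcc (0 : ℝ) 1 zero_le_one (t / dist f g) : ℝ)
    rw [show (1 - a) * f.1 y + a * g.1 y - ((1 - b) * f.1 y + b * g.1 y) =
      (b - a) * (f.1 y - g.1 y) by ring, abs_mul]
    have hab : |b - a| ≤ |s / dist f g - t / dist f g| := by
      rw [abs_sub_comm]
      exact Set.abs_projIcc_sub_projIcc _
    refine (mul_le_mul hab (abs_sub_le_dist f g y) (abs_nonneg _) (abs_nonneg _)).trans ?_
    rw [← sub_div, abs_div, abs_of_nonneg (dist_nonneg (x := f) (y := g))]
    rcases (dist_nonneg (x := f) (y := g)).eq_or_lt with h | h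
    · simp [← h]
    · rw [div_mul_cancel₀ _ h.ne']

end Hull

end PL

theorem mem_hypPL_iff (l : PL G) : l ∈ HypPL G ↔ ∃ n : ℕ, LengthFourPoint l.1 n := by
  constructor
  · rintro ⟨S, _, _, _, s, ⟨-, δ, -, -, -, hδ⟩, hl⟩
    obtain ⟨n, hn⟩ := exists_nat_ge δ
    exact ⟨n, (hδ.lengthFourPoint hl).mono hn⟩
  · rintro ⟨n, hn⟩
    exact ⟨l.Hull, inferInstance, inferInstance, inferInstance, PL.Hull.base l,
      (PL.Hull.isGeodesicSpace l).isHyperbolic n.cast_nonneg (PL.Hull.fourPoint hn),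
      fun g => (PL.Hull.dist_base g).symm⟩

/-- Whether an action on a hyperbolic space is of general type depends only on `l`, so the hull is a
witness here too. -/
theorem mem_hypPLGt_iff (l : PL G) : l ∈ HypPLGt G ↔ l ∈ HypPL G ∧ LengthMovesEndpoints l.1 := by
  constructor
  · rintro ⟨S, _, _, _, s, hS, hgt, hl⟩
    refine ⟨⟨S, _, _, ‹_›, s, hS, hl⟩, ?_⟩
    obtain ⟨-, δ, hδ0, -, -, hδ⟩ := hS
    rwa [lengthMovesEndpoints_iff hl, ← isGeneralType_iff hδ hδ0 s]
  · rintro ⟨hl, hm⟩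
    obtain ⟨n, hn⟩ := (mem_hypPL_iff l).1 hl
    have hδ := PL.Hull.fourPoint hn
    have hd : ∀ g, l.1 g = dist (PL.Hull.base l) (g • PL.Hull.base l) :=
      fun g => (PL.Hull.dist_base g).symm
    refine ⟨l.Hull, inferInstance, inferInstance, inferInstance, PL.Hull.base l,
      (PL.Hull.isGeodesicSpace l).isHyperbolic n.cast_nonneg hδ, ?_, hd⟩
    rwa [isGeneralType_iff hδ n.cast_nonneg (PL.Hull.base l), ← lengthMovesEndpoints_iff hd]

end Hull

/-! ### Polish spaces -/

section Polish

/-- The diagonal map embeds the intersection as a closed subset of the Polish product of `α` and the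
`U i`. -/
theorem polishSpace_iInter_of_isOpen {α : Type*} [TopologicalSpace α] [PolishSpace α] {ι : Type*}
    [Countable ι] {U : ι → Set α} (hU : ∀ i, IsOpen (U i)) : PolishSpace (⋂ i, U i : Set α) := by
  have : ∀ i, PolishSpace (U i) := fun i => (hU i).polishSpace
  let φ : (⋂ i, U i : Set α) → α × ∀ i, U i :=
    fun x => (x.1, fun i => ⟨x.1, Set.mem_iInter.1 x.2 i⟩)
  have hφ : Continuous φ := by fun_prop
  have hemb : IsEmbedding φ := IsEmbedding.of_comp hφ continuous_fst IsEmbedding.subtypeVal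
  have hrange : Set.range φ = ⋂ i, {p : α × ∀ i, U i | (p.2 i : α) = p.1} := by
    ext p
    simp only [Set.mem_range, Set.mem_iInter, Set.mem_ofPred_eq]
    constructor
    · rintro ⟨x, rfl⟩ i
      rfl
    · intro h
      refine ⟨⟨p.1, Set.mem_iInter.2 fun i => h i ▸ (p.2 i).2⟩, Prod.ext rfl (funext fun i => ?_)⟩
      exact Subtype.ext (h i).symm
  have hclosed : IsClosed (Set.range φ) := by
    rw [hrange]
    exact isClosed_iInter fun i => isClosed_eq (by fun_prop) continuous_fst
  exact IsClosedEmbedding.polishSpace ⟨hemb, hclosed⟩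

theorem polishSpace_bool : PolishSpace Bool :=
  (Continuous.isClosedEmbedding (f := fun b : Bool => if b then (1 : ℝ) else 0)
    continuous_of_discreteTopology (by intro a b; cases a <;> cases b <;> simp)).polishSpace

variable {G : Type u} [Group G]

theorem isOpen_isWordOfLength (n : ℕ) (g : G) :
    IsOpen {χ : G → Bool | IsWordOfLength {g | χ g = true} n g} := by
  have : {χ : G → Bool | IsWordOfLength {g | χ g = true} n g} =
      ⋃ w ∈ {w : List G | w.length = n ∧ w.prod = g},
        ⋂ a ∈ {a | a ∈ w}, {χ : G → Bool | χ a = true ∨ χ a⁻¹ = true} := by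
    ext χ
    simp only [IsWordOfLength, Set.mem_ofPred_eq, Set.mem_iUnion, Set.mem_iInter, exists_prop]
    exact exists_congr fun w => by tauto
  rw [this]
  refine isOpen_biUnion fun w _ => w.finite_toSet.isOpen_biInter fun a _ => ?_
  have h (b : G) : IsOpen {χ : G → Bool | χ b = true} := by
    have hb : Continuous fun χ : G → Bool => χ b := continuous_apply b
    exact (isOpen_discrete ({true} : Set Bool)).preimage hb
  exact (h a).union (h a⁻¹)

theorem closure_eq_top_iff_isWordOfLength (X : Set G) :
    Subgroup.closure X = ⊤ ↔ ∀ g, ∃ n, IsWordOfLength X n g := by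
  classical
  constructor
  · intro h g
    have hX : {g : G | (decide (g ∈ X)) = true} = X := by ext; simp
    have := exists_isWordOfLength (⟨fun g => decide (g ∈ X), by rw [hX]; exact h⟩ : Gen G) g
    rwa [Gen.set, hX] at this
  · intro h
    refine eq_top_iff.2 fun g _ => ?_
    obtain ⟨n, w, -, hw, rfl⟩ := h g
    refine Subgroup.list_prod_mem _ fun a ha => ?_
    rcases hw a ha with h | h
    · exact Subgroup.subset_closure h
    · exact (Subgroup.inv_mem_iff _).1 (Subgroup.subset_closure h)

theorem polishSpace_gen [Countable G] : PolishSpace (Gen G) := by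
  have := polishSpace_bool
  have h := polishSpace_iInter_of_isOpen (α := G → Bool)
    (U := fun g => ⋃ n, {χ : G → Bool | IsWordOfLength {g | χ g = true} n g})
    fun g => isOpen_iUnion fun n => isOpen_isWordOfLength n g
  have heq : (⋂ g : G, ⋃ n, {χ : G → Bool | IsWordOfLength {g | χ g = true} n g}) =
      {χ : G → Bool | Subgroup.closure {g : G | χ g = true} = ⊤} := by
    ext χ
    simp [closure_eq_top_iff_isWordOfLength]
  rw [heq] at h
  exact h

theorem polishSpace_pl [Countable G] : PolishSpace (PL G) := by
  have hc : IsClosed {l : G → ℝ | IsPseudoLength l} := by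
    have : {l : G → ℝ | IsPseudoLength l} = (⋂ g, {l | 0 ≤ l g}) ∩ {l | l 1 = 0} ∩
        (⋂ g, {l | l g = l g⁻¹}) ∩ ⋂ g, ⋂ h, {l | l (g * h) ≤ l g + l h} := by
      ext l
      simp only [Set.mem_inter_iff, Set.mem_iInter, Set.mem_ofPred_eq]
      exact ⟨fun h => ⟨⟨⟨h.nonneg, h.one⟩, h.inv⟩, h.mul_le⟩, fun h => ⟨h.1.1.1, h.1.1.2, h.1.2, h.2⟩⟩
    rw [this]
    refine ((IsClosed.inter ?_ ?_).inter ?_).inter ?_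
    · exact isClosed_iInter fun g => isClosed_le (by fun_prop) (by fun_prop)
    · exact isClosed_eq (by fun_prop) (by fun_prop)
    · exact isClosed_iInter fun g => isClosed_eq (by fun_prop) (by fun_prop)
    · exact isClosed_iInter fun g => isClosed_iInter fun h =>
        isClosed_le (by fun_prop) (by fun_prop)
  exact hc.polishSpace

end Polish

/-! ### The quasi-orders -/

section QuasiOrders

variable {G : Type u} [Group G]

theorem PL.Dominated.refl (l : PL G) : PL.Dominated l l :=
  ⟨1, one_pos, fun g => by linarith⟩

theorem PL.Dominated.trans {l₁ l₂ l₃ : PL G} (h : PL.Dominated l₁ l₂) (h' : PL.Dominated l₂ l₃) :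
    PL.Dominated l₁ l₃ := by
  obtain ⟨C, hC, h⟩ := h
  obtain ⟨D, hD, h'⟩ := h'
  refine ⟨C * D + C, by positivity, fun g => ?_⟩
  have h1 := mul_le_mul_of_nonneg_left (h' g) hC.le
  have h2 := mul_nonneg hC.le (l₃.2.nonneg g)
  linarith [h g]

theorem PL.equivalence_equiv : Equivalence (PL.Equiv (G := G)) where
  refl l := ⟨.refl l, .refl l⟩
  symm h := ⟨h.2, h.1⟩
  trans h h' := ⟨h.1.trans h'.1, h'.2.trans h.2⟩

theorem gen_dominated_iff (X Y : Gen G) :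
    Gen.Dominated X Y ↔ PL.Dominated (wordPL X) (wordPL Y) := by
  constructor
  · rintro ⟨K, hK, h⟩
    refine ⟨K + 1, by positivity, fun g => ?_⟩
    have h1 := h 1 g
    simp only [wordDist, inv_one, one_mul] at h1
    have h2 : (0 : ℝ) ≤ wordLength Y g := Nat.cast_nonneg _
    simp only [wordPL]
    linarith
  · rintro ⟨C, hC, h⟩
    -- For a nontrivial element the `Y`-length is at least 1, so the additive `C` is at most `C`
    -- times that length.
    refine ⟨2 * C, by positivity, fun g h' => ?_⟩
    have h1 := h (g⁻¹ * h')
    simp only [wordPL] at h1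
    unfold wordDist
    rcases Nat.eq_zero_or_pos (wordLength Y (g⁻¹ * h')) with h0 | h0
    · rw [h0, eq_one_of_wordLength_eq_zero h0, wordLength_one]
      simp
    · have h2 : (1 : ℝ) ≤ wordLength Y (g⁻¹ * h') := by exact_mod_cast h0
      nlinarith

theorem gen_equiv_iff (X Y : Gen G) : Gen.Equiv X Y ↔ PL.Equiv (wordPL X) (wordPL Y) :=
  and_congr (gen_dominated_iff X Y) (gen_dominated_iff Y X)

theorem Gen.equivalence_equiv : Equivalence (Gen.Equiv (G := G)) where
  refl X := (gen_equiv_iff X X).2 (PL.equivalence_equiv.refl _)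
  symm h := ⟨h.2, h.1⟩
  trans h h' := (gen_equiv_iff _ _).2
    (PL.equivalence_equiv.trans ((gen_equiv_iff _ _).1 h) ((gen_equiv_iff _ _).1 h'))

end QuasiOrders

/-! ### Measurability -/

section Measurability

variable {G : Type u} [Group G]

theorem measurable_pl_apply (g : G) : Measurable fun l : PL G => l.1 g :=
  (measurable_pi_apply g).comp measurable_subtype_coe

theorem measurable_lengthProduct (x y : G) : Measurable fun l : PL G => lengthProduct l.1 x y :=
  (((measurable_pl_apply x).add (measurable_pl_apply y)).sub (measurable_pl_apply _)).div_const 2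

theorem measurable_lengthTends (x y : ℕ → G) : Measurable fun l : PL G => LengthTends l.1 x y :=
  Measurable.forall fun _ => Measurable.exists fun _ => Measurable.forall fun _ =>
    Measurable.forall fun _ => Measurable.forall fun _ => Measurable.forall fun _ =>
      measurableSet_setOfPred.1 (measurableSet_le measurable_const (measurable_lengthProduct _ _))

variable [Countable G]

/-- Second countability identifies the Borel structure on a product with the product of the Borel
structures. -/
instance : SecondCountableTopology (Gen G) := by
  have := polishSpace_gen (G := G)
  infer_instance

instance : SecondCountableTopology (PL G) := by
  have := polishSpace_pl (G := G)
  infer_instance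

theorem measurableSet_pl_dominated :
    MeasurableSet {p : PL G × PL G | PL.Dominated p.1 p.2} := by
  have : {p : PL G × PL G | PL.Dominated p.1 p.2} =
      -- Lengths are nonnegative, so `C` may be enlarged to a positive integer and its quantifier
      -- becomes countable.
      ⋃ n : ℕ, ⋂ g : G, {p : PL G × PL G | p.1.1 g ≤ (n + 1 : ℝ) * p.2.1 g + (n + 1 : ℝ)} := by
    ext p
    simp only [PL.Dominated, Set.mem_ofPred_eq, Set.mem_iUnion, Set.mem_iInter]
    constructor
    · rintro ⟨C, hC, h⟩
      obtain ⟨n, hn⟩ := exists_nat_ge C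
      refine ⟨n, fun g => (h g).trans ?_⟩
      have := mul_le_mul_of_nonneg_right (hn.trans (lt_add_one _).le) (p.2.2.nonneg g)
      linarith
    · rintro ⟨n, h⟩
      exact ⟨n + 1, by positivity, h⟩
  rw [this]
  refine MeasurableSet.iUnion fun n => MeasurableSet.iInter fun g => ?_
  exact measurableSet_le ((measurable_pl_apply g).comp measurable_fst)
    ((((measurable_pl_apply g).comp measurable_snd).const_mul _).add_const _)

theorem measurableSet_pl_equiv : MeasurableSet {p : PL G × PL G | PL.Equiv p.1 p.2} :=
  measurableSet_pl_dominated.inter (measurable_swap measurableSet_pl_dominated)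

theorem measurable_wordPL : Measurable (wordPL : Gen G → PL G) := by
  refine Measurable.subtype_mk (measurable_pi_iff.2 fun g => ?_)
  have h : Measurable fun X : Gen G => wordLength X g := by
    refine measurable_of_Iic fun n => ?_
    have : (fun X : Gen G => wordLength X g) ⁻¹' Set.Iic n = ⋃ m ∈ Set.Iic n,
        (Subtype.val : Gen G → G → Bool) ⁻¹'
          {χ : G → Bool | IsWordOfLength {g | χ g = true} m g} := by
      ext X
      simp only [Set.mem_preimage, Set.mem_Iic, Set.mem_iUnion, exists_prop, Set.mem_ofPred_eq]
      constructor
      · exact fun h => ⟨_, h, isWordOfLength_wordLength X g⟩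
      · rintro ⟨m, hm, h⟩
        exact (wordLength_le h).trans hm
    rw [this]
    exact (isOpen_biUnion fun m _ =>
      (isOpen_isWordOfLength m g).preimage continuous_subtype_val).measurableSet
  exact measurable_from_top.comp h

theorem measurableSet_gen_dominated :
    MeasurableSet {p : Gen G × Gen G | Gen.Dominated p.1 p.2} := by
  simp only [gen_dominated_iff]
  exact (measurable_wordPL.prodMap measurable_wordPL) measurableSet_pl_dominated

theorem measurableSet_gen_equiv : MeasurableSet {p : Gen G × Gen G | Gen.Equiv p.1 p.2} :=
  measurableSet_gen_dominated.inter (measurable_swap measurableSet_gen_dominated)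

theorem measurable_lengthFourPoint (δ : ℝ) : Measurable fun l : PL G => LengthFourPoint l.1 δ :=
  Measurable.forall fun x => Measurable.forall fun y => Measurable.forall fun z =>
    measurableSet_setOfPred.1 (measurableSet_le
      (((measurable_lengthProduct x y).min (measurable_lengthProduct y z)).sub_const δ)
      (measurable_lengthProduct x z))

theorem measurable_lengthMovesEndpoints :
    Measurable fun l : PL G => LengthMovesEndpoints l.1 :=
  Measurable.exists fun _ => ((measurable_lengthTends _ _).and
    ((measurable_lengthTends _ _).and (measurable_lengthTends _ _).not)).and
    ((Measurable.exists fun _ => (measurable_lengthTends _ _).not.and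
      (measurable_lengthTends _ _).not).and
      (Measurable.exists fun _ => (measurable_lengthTends _ _).not))

theorem measurableSet_hypPL : MeasurableSet (HypPL G) := by
  have : HypPL G = {l | ∃ n : ℕ, LengthFourPoint l.1 n} := Set.ext mem_hypPL_iff
  rw [this]
  exact measurableSet_setOfPred.2 (Measurable.exists fun n => measurable_lengthFourPoint n)

theorem measurableSet_hypPLGt : MeasurableSet (HypPLGt G) := by
  have : HypPLGt G = HypPL G ∩ {l | LengthMovesEndpoints l.1} := Set.ext mem_hypPLGt_iff
  rw [this]
  exact measurableSet_hypPL.inter (measurableSet_setOfPred.2 measurable_lengthMovesEndpoints)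

theorem measurableSet_hyp : MeasurableSet (Hyp G) := by
  have : Hyp G = wordPL ⁻¹' HypPL G :=
    Set.ext fun X => (mem_hyp_iff X).trans (mem_hypPL_iff (wordPL X)).symm
  rw [this]
  exact measurable_wordPL measurableSet_hypPL

theorem measurableSet_hypGt : MeasurableSet (HypGt G) := by
  have : HypGt G = Hyp G ∩ wordPL ⁻¹' {l | LengthMovesEndpoints l.1} := Set.ext mem_hypGt_iff
  rw [this]
  exact measurableSet_hyp.inter
    (measurable_wordPL (measurableSet_setOfPred.2 measurable_lengthMovesEndpoints))

end Measurability

end HypAct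

end

theorem mainTheorem9 (G : Type*) [Group G] [Countable G] :
    -- the space of generating sets
    (PolishSpace (Gen G) ∧
      (∀ X : Gen G, Gen.Dominated X X) ∧
      (∀ X Y Z : Gen G, Gen.Dominated X Y → Gen.Dominated Y Z → Gen.Dominated X Z) ∧
      Equivalence (Gen.Equiv (G := G)) ∧
      MeasurableSet[borel (Gen G × Gen G)] {p : Gen G × Gen G | Gen.Dominated p.1 p.2} ∧
      MeasurableSet[borel (Gen G × Gen G)] {p : Gen G × Gen G | Gen.Equiv p.1 p.2}) ∧
    -- the space of pseudo-length functions
    (PolishSpace (PL G) ∧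
      (∀ l : PL G, PL.Dominated l l) ∧
      (∀ l₁ l₂ l₃ : PL G, PL.Dominated l₁ l₂ → PL.Dominated l₂ l₃ → PL.Dominated l₁ l₃) ∧
      Equivalence (PL.Equiv (G := G)) ∧
      MeasurableSet[borel (PL G × PL G)] {p : PL G × PL G | PL.Dominated p.1 p.2} ∧
      MeasurableSet[borel (PL G × PL G)] {p : PL G × PL G | PL.Equiv p.1 p.2}) ∧
    -- the map sending a generating set to its word length is a Borel reduction
    (@Measurable (Gen G) (PL G) (borel (Gen G)) (borel (PL G)) wordPL ∧
      (∀ X Y : Gen G, Gen.Dominated X Y ↔ PL.Dominated (wordPL X) (wordPL Y)) ∧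
      (∀ X Y : Gen G, Gen.Equiv X Y ↔ PL.Equiv (wordPL X) (wordPL Y))) ∧
    -- the hyperbolic and general type subsets
    (MeasurableSet[borel (Gen G)] (Hyp G) ∧ MeasurableSet[borel (Gen G)] (HypGt G)) ∧
    (MeasurableSet[borel (PL G)] (HypPL G) ∧ MeasurableSet[borel (PL G)] (HypPLGt G)) := by
  refine ⟨⟨polishSpace_gen, fun X => (Gen.equivalence_equiv.refl X).1, fun X Y Z h h' => ?_,
    Gen.equivalence_equiv, ?_, ?_⟩, ⟨polishSpace_pl, PL.Dominated.refl,
    fun _ _ _ => PL.Dominated.trans, PL.equivalence_equiv, ?_, ?_⟩,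
    ⟨?_, gen_dominated_iff, gen_equiv_iff⟩, ⟨?_, ?_⟩, ?_, ?_⟩
  · rw [gen_dominated_iff] at h h' ⊢
    exact h.trans h'
  · rw [← BorelSpace.measurable_eq]
    exact measurableSet_gen_dominated
  · rw [← BorelSpace.measurable_eq]
    exact measurableSet_gen_equiv
  · rw [← BorelSpace.measurable_eq]
    exact measurableSet_pl_dominated
  · rw [← BorelSpace.measurable_eq]
    exact measurableSet_pl_equiv
  · rw [← BorelSpace.measurable_eq, ← BorelSpace.measurable_eq]
    exact measurable_wordPL
  · rw [← BorelSpace.measurable_eq]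
    exact measurableSet_hyp
  · rw [← BorelSpace.measurable_eq]
    exact measurableSet_hypGt
  · rw [← BorelSpace.measurable_eq]
    exact measurableSet_hypPL
  · rw [← BorelSpace.measurable_eq]
    exact measurableSet_hypPLGt
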